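/- Let $P$ be a strictly convex polygon with $n\ge 3$ vertices, given as an array in clockwise order. A triangle is \emph{$P$-aligned} if its vertices are vertices of $P$, and \emph{rooted at} a vertex $r$ if it is $P$-aligned and has $r$ as a vertex. Two $P$-aligned triangles \emph{interleave} if between every two cyclically successive vertices of either one there is a vertex of the other (possibly coinciding with one of them). Consider the following recursive algorithm. If $n\le 9$, compute a largest-area rooted triangle for every root and return the largest one. Otherwise: (1) choose an arbitrary vertex $a$ and compute a largest-area triangle $T_a$ rooted at $a$, by a linear sweep in which the second vertex $b$ runs once along the polygon and the third vertex $c$ only moves forward, as long as the area of $\triangle abc$ does not decrease; (2) let $m$ be the median vertex of a largest one (in number of vertices) of the three boundary intervals cut out by $T_a$, and compute in the same way a largest-area triangle $T_m$ rooted at $m$; (3) the vertices $x_0\le x_1\le\dots\le x_5$ of $T_a$ and $T_m$, in order along the boundary, cut it into six intervals sharing their endpoints; let $P'$ be the polygon on the vertices in $[x_0,x_1]\cup[x_2,x_3]\cup[x_4,x_5]$ and $P''$ the polygon on the vertices in $[x_1,x_2]\cup[x_3,x_4]\cup[x_5,x_0]$; (4) if $T_a$ and $T_m$ interleave, recurse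 on $P'$ and $P''$ and return the larger result; otherwise recurse only on $P'$ if each of the pairs $\{x_1,x_2\},\{x_3,x_4\},\{x_5,x_0\}$ contains a vertex of $T_a$ and a vertex of $T_m$ (i.e. $P'$ can contain a triangle that interleaves with both), and only on $P''$ if not. Then the following hold. (i) For every vertex $r$ of $P$, the sweep at $r$ returns a triangle of largest area among all triangles rooted at $r$. (ii) If $n\ge 4$, then for every choice of $a$ the one or two subproblems produced by (1)--(4) are convex polygons on vertices of $P$ with at most $\frac56(n+6)$ vertices each, and every $P$-aligned triangle that has the largest area among all triangles contained in $P$ has all three vertices in at least one of them. (iii) There is an absolute constant $C$ such that for every $P$, and whatever roots $a$ are chosen in the recursive calls, the algorithm terminates after at most $C\,n\log n$ elementary operations (real RAM with unit cost for arithmetic, comparisons, reading an array entry and appending to an array) and returns a $P$-aligned triangle whose area is the largest among all triangles contained in $P$. -/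

import Mathlib

noncomputable section

namespace InscribedTriangle

/-! ### Geometry -/

/-- A point of the plane. -/
abbrev Pt : Type := ℝ × ℝ

/-- A triangle, given by its three vertices. -/
abbrev Tri : Type := Pt × Pt × Pt

/-- Twice the signed area of the triangle `p q r`; it is negative iff `p, q, r` is a clockwise turn. -/
def cross (p q r : Pt) : ℝ :=
  (q.1 - p.1) * (r.2 - p.2) - (q.2 - p.2) * (r.1 - p.1)

/-- The area of a triangle. -/
def area (T : Tri) : ℝ := |cross T.1 T.2.1 T.2.2| / 2

/-- The vertex with cyclic index `i` of the polygon stored in the array `P`. -/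
def vtx (P : Array Pt) (i : ℕ) : Pt := P.getD (i % P.size) 0

/-- The array `P` lists the vertices of a (strictly) convex polygon in clockwise order. -/
def IsConvexPolygon (P : Array Pt) : Prop :=
  3 ≤ P.size ∧ ∀ i j k : ℕ, i < j → j < k → k < P.size → cross (vtx P i) (vtx P j) (vtx P k) < 0

/-- All three vertices of `T` are vertices of the polygon `P`. -/
def Aligned (P : Array Pt) (T : Tri) : Prop := T.1 ∈ P ∧ T.2.1 ∈ P ∧ T.2.2 ∈ P

/-- The (closed) region bounded by the convex polygon `P`. -/
def region (P : Array Pt) : Set Pt := convexHull ℝ {p | p ∈ P}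

/-- `T` has its vertices among those of `P`, and its area is the largest one
among all triangles contained in `P`. -/
def IsLargest (P : Array Pt) (T : Tri) : Prop :=
  Aligned P T ∧ ∀ p ∈ region P, ∀ q ∈ region P, ∀ r ∈ region P, area (p, q, r) ≤ area T

/-- `T` has its vertices among those of `P`, one of them is `v`, and `T` has the largest area
among all such triangles. -/
def IsLargestRooted (P : Array Pt) (v : Pt) (T : Tri) : Prop :=
  (Aligned P T ∧ T.1 = v) ∧ ∀ q ∈ P, ∀ r ∈ P, area (v, q, r) ≤ area T

/-! ### Counting steps

The model is a real RAM. Elementary operations, each of unit cost, are: an arithmetic operation,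
comparison or logical operation on real numbers, indices or truth values; reading an entry of an
array; appending an entry to an array. -/

/-- A computation: its result, together with the number of elementary operations it performs. -/
structure Timed (α : Type) where
  val : α
  time : ℕ

instance : Monad Timed where
  pure a := ⟨a, 0⟩
  bind x f := ⟨(f x.val).val, x.time + (f x.val).time⟩

/-- `ops k a` is straight-line code of at most `k` elementary operations with result `a`.
It is only used with numerals `k`. -/
def ops {α : Type} (k : ℕ) (a : α) : Timed α := ⟨a, k⟩

/-! ### The largest triangle rooted at a vertex

Vertices are addressed by their offset from the root `r` along the polygon. -/

/-- The triangle with vertices at offsets `0`, `b`, `c` from the vertex with index `r`. -/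
def triAt (P : Array Pt) (r b c : ℕ) : Tri := (vtx P r, vtx P (r + b), vtx P (r + c))

/-- Advance the third vertex `c` as long as this does not decrease the area. -/
def climb (P : Array Pt) (r b c : ℕ) : Timed ℕ :=
  if _h : c + 1 < P.size then do
    let up ← ops 50 (decide (area (triAt P r b c) ≤ area (triAt P r b (c + 1))))
    if up then climb P r b (c + 1) else pure c
  else ops 2 c
termination_by P.size - c

/-- For the remaining positions of the second vertex `b`, advance `c` (which is never moved back)
and keep the best triangle seen. -/
def sweep (P : Array Pt) (r b c : ℕ) (best : ℕ × ℕ) : Timed (ℕ × ℕ) :=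
  if _h : b + 1 < P.size then do
    let c₀ ← ops 4 (max c (b + 1))
    let c₁ ← climb P r b c₀
    let better ← ops 50 (decide (area (triAt P r best.1 best.2) < area (triAt P r b c₁)))
    sweep P r (b + 1) c₁ (if better then (b, c₁) else best)
  else ops 2 best
termination_by P.size - b

/-- Offsets `(b, c)`, `b < c`, of the other two vertices of the triangle found for the root `r`. -/
def rootedOffsets (P : Array Pt) (r : ℕ) : Timed (ℕ × ℕ) := sweep P r 1 2 (1, 2)

/-- The triangle found for the root with index `r`. -/
def rootedTriangle (P : Array Pt) (r : ℕ) : Timed Tri := do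
  let o ← rootedOffsets P r
  ops 12 (triAt P r o.1 o.2)

/-! ### Dividing a polygon

Below, `a` is the root of the first dividing triangle, and all vertices are addressed by their
offsets from `a`, which are numbers in `{0, …, n - 1}`. -/

/-- First vertex and length (number of edges) of a longest one of the three intervals into which
the vertices `0 < b < c` cut the boundary of an `n`-gon. -/
def longestInterval (n b c : ℕ) : ℕ × ℕ :=
  if c - b ≤ b ∧ n - c ≤ b then (0, b)
  else if n - c ≤ c - b then (b, c - b)
  else (c, n - c)

/-- For increasing triples `u`, `v`: between every two cyclically successive members of `u`
there is a member of `v`, possibly coinciding with one of them. -/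
def Separates (v u : List ℕ) : Prop :=
  (∃ x ∈ v, u.getD 0 0 ≤ x ∧ x ≤ u.getD 1 0) ∧ (∃ x ∈ v, u.getD 1 0 ≤ x ∧ x ≤ u.getD 2 0) ∧
    (∃ x ∈ v, u.getD 2 0 ≤ x ∨ x ≤ u.getD 0 0)

/-- The triangles with vertices at the offsets in the increasing triples `u` and `v` interleave. -/
def Interleave (u v : List ℕ) : Prop := Separates v u ∧ Separates u v

/-- One of `x`, `y` belongs to `u`, and one of them belongs to `v`. -/
def Mixed (u v : List ℕ) (x y : ℕ) : Prop := (x ∈ u ∨ y ∈ u) ∧ (x ∈ v ∨ y ∈ v)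

open Classical in
/-- The polygon formed by the vertices with offset `i < k` from `a` that satisfy `keep i`. -/
def select (P : Array Pt) (a : ℕ) (keep : ℕ → Prop) : ℕ → Timed (Array Pt)
  | 0 => ops 1 #[]
  | k + 1 => do
    let Q ← select P a keep k
    let t ← ops 40 (decide (keep k))
    if t then ops 6 (Q.push (vtx P (a + k))) else pure Q

/-- One or two subproblems. -/
inductive Split where
  | one (Q : Array Pt)
  | two (Q R : Array Pt)

/-- The list of the subproblems. -/
def Split.parts : Split → List (Array Pt)
  | .one Q => [Q]
  | .two Q R => [Q, R]

open Classical in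
/-- The six vertices of the dividing triangles, `X 0 ≤ ⋯ ≤ X 5` along the boundary, cut it into six
intervals that share their endpoints; the two candidate subpolygons consist of every other interval.
A triangle with one vertex in each of the intervals of the first candidate is separated by the
pairs `{X 1, X 2}`, `{X 3, X 4}`, `{X 5, X 0}`, so it can interleave with both dividing triangles
iff each of these pairs contains a vertex of either of them. -/
def divide (P : Array Pt) (a : ℕ) : Timed Split := do
  let n := P.size
  let oa ← rootedOffsets P a
  let I ← ops 12 (longestInterval n oa.1 oa.2)
  let m ← ops 2 (I.1 + I.2 / 2)
  let r ← ops 2 ((a + m) % n)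
  let om ← rootedOffsets P r
  let Ta ← ops 3 [0, oa.1, oa.2]
  let Tm ← ops 30 (List.insertionSort (· ≤ ·) [m, (m + om.1) % n, (m + om.2) % n])
  let L ← ops 60 (List.insertionSort (· ≤ ·) (Ta ++ Tm))
  let X : ℕ → ℕ := fun i => L.getD i 0
  let P₁ ← select P a (fun i => X 0 ≤ i ∧ i ≤ X 1 ∨ X 2 ≤ i ∧ i ≤ X 3 ∨ X 4 ≤ i ∧ i ≤ X 5) n
  let P₂ ← select P a (fun i => X 1 ≤ i ∧ i ≤ X 2 ∨ X 3 ≤ i ∧ i ≤ X 4 ∨ X 5 ≤ i ∨ i ≤ X 0) n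
  let both ← ops 100 (decide (Interleave Ta Tm))
  if both then
    pure (.two P₁ P₂)
  else
    let first ← ops 100 (decide
      (Mixed Ta Tm (X 1) (X 2) ∧ Mixed Ta Tm (X 3) (X 4) ∧ Mixed Ta Tm (X 5) (X 0)))
    if first then pure (.one P₁) else pure (.one P₂)

/-! ### The divide-and-conquer algorithm -/

/-- The larger one of two triangles. -/
def larger (T S : Tri) : Timed Tri := do
  let t ← ops 50 (decide (area T ≤ area S))
  if t then pure S else pure T

/-- The larger one of two results; `none` stands for a call that has not returned. -/
def largerResult : Option Tri → Option Tri → Timed (Option Tri)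
  | some T, some S => do
    let U ← larger T S
    pure (some U)
  | _, _ => pure none

/-- The largest one of the triangles found for the roots `0, …, k`. -/
def bestOverRoots (P : Array Pt) : ℕ → Timed Tri
  | 0 => rootedTriangle P 0
  | k + 1 => do
    let T ← bestOverRoots P k
    let S ← rootedTriangle P (k + 1)
    larger T S

/-- The recursive procedure. Polygons of constant size, at most nine vertices, are solved directly.
The number `choice path` selects the root in the call that is reached from the initial call by the
sequence `path` of first / second recursive calls, so a function `choice` is an arbitrary sequence
of choices of roots. The first explicit argument bounds the depth of the recursion; the result is
`none` if that bound was ever exceeded. -/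
def solve (choice : List Bool → ℕ) : ℕ → List Bool → Array Pt → Timed (Option Tri)
  | 0, _, _ => pure none
  | d + 1, path, P => do
    let small ← ops 1 (decide (P.size ≤ 9))
    if small then
      let T ← bestOverRoots P (P.size - 1)
      pure (some T)
    else
      let a ← ops 2 (choice path % P.size)
      let s ← divide P a
      match s with
      | .one Q => solve choice d (false :: path) Q
      | .two Q R => do
        let T ← solve choice d (false :: path) Q
        let S ← solve choice d (true :: path) R
        largerResult T S

/-- The divide-and-conquer algorithm on the polygon `P`, with arbitrary roots given by `choice`. -/
def largestTriangle (choice : List Bool → ℕ) (P : Array Pt) : Timed (Option Tri) :=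
  solve choice P.size [] P

end InscribedTriangle

end

/-!
Let two triangles be inscribed in a strictly convex polygon, one of them largest among all, the
other one largest for one of its vertices. If they did not interleave, then exchanging one vertex
between them would enlarge one of the two. Hence a largest triangle `T` interleaves with both
dividing triangles, which forces its vertices into alternate intervals of the boundary: all of `T`
survives in `P'` or in `P''`. As the second root is the median of a longest interval cut out by the
first triangle, every subproblem misses a gap of about `n / 6` vertices next to that root. Two
subproblems have only the six vertices of the dividing triangles in common, so the potential
`(n - 6) * log n` absorbs the linear cost of dividing.
-/

namespace InscribedTriangle

/-! ### Areas in convex position -/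

/-- Twice the signed area of a triangle, with the sign that makes clockwise triangles positive. -/
def cw (p q r : Pt) : ℝ := -cross p q r

theorem cw_rotate (p q r : Pt) : cw q r p = cw p q r := by
  simp only [cw, cross]; ring

theorem cw_swap (p q r : Pt) : cw p r q = -cw p q r := by
  simp only [cw, cross]; ring

theorem area_eq_abs_cw (p q r : Pt) : area (p, q, r) = |cw p q r| / 2 := by
  simp only [area, cw, abs_neg]

theorem cw_self_left (p q : Pt) : cw p p q = 0 := by
  simp only [cw, cross]; ring

theorem cw_self_right (p q : Pt) : cw p q q = 0 := by
  simp only [cw, cross]; ring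

theorem cw_self_outer (p q : Pt) : cw p q p = 0 := by
  simp only [cw, cross]; ring

theorem cw_lt_of_base_end {p q q' x y : Pt} (hqx : 0 < cw p q x) (hq'x : 0 ≤ cw p q' x)
    (hqq' : 0 < cw p q q') (hxy : 0 < cw p x y) (h : cw p q x ≤ cw p q y) :
    cw p q' x < cw p q' y := by
  have key : cw p q x * (cw p q' y - cw p q' x) =
      cw p q' x * (cw p q y - cw p q x) + cw p q q' * cw p x y := by
    simp only [cw, cross]; ring
  refine sub_pos.1 ((mul_pos_iff_of_pos_left hqx).1 (key ▸ ?_))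
  exact add_pos_of_nonneg_of_pos (mul_nonneg hq'x (sub_nonneg.2 h)) (mul_pos hqq' hxy)

theorem cw_lt_of_base_start {p p' q x y : Pt} (hqx : 0 < cw p q x) (hp'x : 0 ≤ cw p' q x)
    (hpp' : 0 < cw p p' q) (hxy : 0 < cw q x y) (h : cw p q x ≤ cw p q y) :
    cw p' q x < cw p' q y := by
  have key : cw p q x * (cw p' q y - cw p' q x) =
      cw p' q x * (cw p q y - cw p q x) + cw p p' q * cw q x y := by
    simp only [cw, cross]; ring
  refine sub_pos.1 ((mul_pos_iff_of_pos_left hqx).1 (key ▸ ?_))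
  exact add_pos_of_nonneg_of_pos (mul_nonneg hp'x (sub_nonneg.2 h)) (mul_pos hpp' hxy)

theorem cw_unimodal {p q x y z : Pt} (hpxy : 0 < cw p x y) (hpyz : 0 ≤ cw p y z)
    (hxyz : 0 < cw x y z) (hy : 0 < cw p q y) (h : cw p q y ≤ cw p q x) :
    cw p q z < cw p q y := by
  by_contra! hc
  have collinear : cw p x z * cw p q y = cw p y z * cw p q x + cw p x y * cw p q z := by
    simp only [cw, cross]; ring
  have decompose : cw x y z + cw p x z = cw p y z + cw p x y := by
    simp only [cw, cross]; ring
  have h₁ := mul_le_mul_of_nonneg_left h hpyz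
  have h₂ := mul_le_mul_of_nonneg_left hc hpxy.le
  have h₃ := mul_pos hxyz hy
  have h₄ : (cw x y z + cw p x z) * cw p q y = (cw p y z + cw p x y) * cw p q y := by
    rw [decompose]
  linarith

/-- Here and below `T₀, T₁, A₁, A₂, T₂, A₀` are in convex position, in this order. -/
theorem cw_lt_of_largest_of_le {T₀ T₁ T₂ A₀ A₁ A₂ : Pt} (hT : 0 < cw T₀ T₁ T₂)
    (hA₁ : 0 < cw T₀ A₁ T₂) (hcap : 0 < cw T₁ A₁ T₂) (hA₂ : 0 ≤ cw T₀ A₂ T₂)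
    (hA₀ : 0 ≤ cw T₂ A₀ T₀) (hdecr : cw T₀ A₂ T₂ < cw T₀ A₁ T₂)
    (max_A₁ : cw T₀ A₁ T₂ ≤ cw T₀ T₁ T₂) (max_A₂ : cw T₀ T₁ A₂ ≤ cw T₀ T₁ T₂)
    (max_A₀ : cw A₀ T₁ T₂ ≤ cw T₀ T₁ T₂) (hne : 0 < cw T₀ A₂ T₂ ∨ 0 < cw T₀ T₁ A₀)
    (hle : cw T₁ A₂ T₂ ≤ cw T₁ A₁ T₂) : cw A₀ A₁ A₂ < cw T₀ A₁ T₂ := by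
  have key : cw T₀ T₁ T₂ * (cw T₀ A₁ T₂ - cw A₀ A₁ A₂) =
      cw T₀ A₁ T₂ * (cw T₀ T₁ T₂ - cw T₀ T₁ A₂) + cw T₀ T₁ A₁ * cw T₀ A₂ T₂ +
        (cw T₂ A₀ T₀ * (cw T₁ A₁ T₂ - cw T₁ A₂ T₂) +
          (cw T₀ T₁ T₂ - cw A₀ T₁ T₂) * (cw T₀ A₁ T₂ - cw T₀ A₂ T₂)) := by
    simp only [cw, cross]; ring
  have hu : cw T₀ T₁ A₁ = cw T₁ A₁ T₂ + (cw T₀ T₁ T₂ - cw T₀ A₁ T₂) := by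
    simp only [cw, cross]; ring
  have hw : cw T₁ A₂ T₂ = cw T₀ A₂ T₂ + cw T₀ T₁ A₂ - cw T₀ T₁ T₂ := by
    simp only [cw, cross]; ring
  have hy : cw T₀ T₁ A₀ = cw T₂ A₀ T₀ + (cw T₀ T₁ T₂ - cw A₀ T₁ T₂) := by
    simp only [cw, cross]; ring
  have hu_pos : 0 < cw T₀ T₁ A₁ := by linarith
  have term₁ := mul_nonneg hA₁.le (sub_nonneg.2 max_A₂)
  have term₂ := mul_nonneg hu_pos.le hA₂
  have term₃ := mul_nonneg hA₀ (sub_nonneg.2 hle)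
  have term₄ := mul_nonneg (sub_nonneg.2 max_A₀) (sub_nonneg.2 hdecr.le)
  refine sub_pos.1 ((mul_pos_iff_of_pos_left hT).1 (key ▸ ?_))
  rcases hA₂.lt_or_eq with hp | hp
  · linarith [mul_pos hu_pos hp]
  rcases hA₀.lt_or_eq with hx | hx
  · linarith [mul_pos hx (show 0 < cw T₁ A₁ T₂ - cw T₁ A₂ T₂ by linarith)]
  · have : 0 < cw T₀ T₁ A₀ := hne.resolve_left hp.symm.not_gt
    linarith [mul_pos (show 0 < cw T₀ T₁ T₂ - cw A₀ T₁ T₂ by linarith) (sub_pos.2 hdecr)]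

theorem cw_lt_of_largest_of_lt {T₀ T₁ T₂ A₀ A₁ A₂ : Pt} (hT : 0 < cw T₀ T₁ T₂)
    (hcap : 0 < cw T₁ A₁ T₂) (hc : 0 < cw T₁ A₁ A₂) (max_A₁ : cw T₀ A₁ T₂ ≤ cw T₀ T₁ T₂)
    (max_A₂ : cw T₀ T₁ A₂ ≤ cw T₀ T₁ T₂) (max_A₀ : cw A₀ T₁ T₂ ≤ cw T₀ T₁ T₂)
    (max_A₀A₂ : cw A₀ T₁ A₂ ≤ cw T₀ T₁ T₂) (hlt : cw T₁ A₁ T₂ < cw T₁ A₂ T₂) :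
    cw A₀ A₁ A₂ < cw T₀ A₁ T₂ := by
  have key : cw T₀ T₁ T₂ * cw T₁ A₂ T₂ * (cw T₀ A₁ T₂ - cw A₀ A₁ A₂) =
      cw T₀ T₁ T₂ * ((cw T₁ A₂ T₂ - cw T₁ A₁ T₂) * (cw T₀ T₁ T₂ - cw A₀ T₁ A₂)) +
        cw T₀ T₁ T₂ * ((cw T₀ T₁ T₂ - cw A₀ T₁ T₂) * cw T₁ A₁ A₂) +
        (cw T₀ T₁ T₂ - cw T₀ T₁ A₂) *
          (cw T₀ T₁ T₂ * cw T₁ A₁ A₂ + cw T₁ A₁ T₂ * cw T₀ A₂ T₂) +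
        cw T₁ A₂ T₂ * (cw T₀ T₁ A₁ * cw T₀ A₂ T₂) := by
    simp only [cw, cross]; ring
  have hu : cw T₀ T₁ A₁ = cw T₁ A₁ T₂ + (cw T₀ T₁ T₂ - cw T₀ A₁ T₂) := by
    simp only [cw, cross]; ring
  have hp : cw T₀ A₂ T₂ = cw T₁ A₂ T₂ + (cw T₀ T₁ T₂ - cw T₀ T₁ A₂) := by
    simp only [cw, cross]; ring
  have hw_pos : 0 < cw T₁ A₂ T₂ := hcap.trans hlt
  have hu_pos : 0 < cw T₀ T₁ A₁ := by linarith
  have hp_pos : 0 < cw T₀ A₂ T₂ := by linarith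
  refine sub_pos.1 ((mul_pos_iff_of_pos_left (mul_pos hT hw_pos)).1 (key ▸ ?_))
  have := sub_nonneg.2 max_A₂
  have := sub_nonneg.2 max_A₀
  have := sub_nonneg.2 max_A₀A₂
  have := sub_pos.2 hlt
  positivity

theorem cw_lt_of_largest {T₀ T₁ T₂ A₀ A₁ A₂ : Pt} (hT : 0 < cw T₀ T₁ T₂)
    (hA₁ : 0 < cw T₀ A₁ T₂) (hcap : 0 < cw T₁ A₁ T₂) (hA₂ : 0 ≤ cw T₀ A₂ T₂)
    (hc : 0 < cw T₁ A₁ A₂) (hc' : 0 ≤ cw A₁ A₂ T₂) (hA₀ : 0 ≤ cw T₂ A₀ T₀)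
    (max_A₁ : cw T₀ A₁ T₂ ≤ cw T₀ T₁ T₂) (max_A₂ : cw T₀ T₁ A₂ ≤ cw T₀ T₁ T₂)
    (max_A₀ : cw A₀ T₁ T₂ ≤ cw T₀ T₁ T₂) (max_A₀A₂ : cw A₀ T₁ A₂ ≤ cw T₀ T₁ T₂)
    (hne : 0 < cw T₀ A₂ T₂ ∨ 0 < cw T₀ T₁ A₀) : cw A₀ A₁ A₂ < cw T₀ A₁ T₂ := by
  rcases le_or_gt (cw T₁ A₂ T₂) (cw T₁ A₁ T₂) with hle | hlt
  · have hdecr : cw T₂ T₀ A₂ < cw T₂ T₀ A₁ :=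
      cw_unimodal (x := T₁) (cw_rotate T₂ T₁ A₁ ▸ hcap) (cw_rotate T₂ A₁ A₂ ▸ hc') hc
        (cw_rotate T₂ T₀ A₁ ▸ hA₁) (by rwa [← cw_rotate T₂, ← cw_rotate T₂])
    rw [← cw_rotate T₂, ← cw_rotate T₂] at hdecr
    exact cw_lt_of_largest_of_le hT hA₁ hcap hA₂ hA₀ hdecr max_A₁ max_A₂ max_A₀ hne hle
  · exact cw_lt_of_largest_of_lt hT hcap hc max_A₁ max_A₂ max_A₀ max_A₀A₂ hlt

/-! ### Cyclic sequences in convex position -/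

/-- The sequence `V` runs periodically, with period `n`, through the vertices of a strictly convex
polygon in clockwise order. Indexing by `ℤ` makes cyclic order a matter of inequalities. -/
structure IsCyclicConvex (n : ℤ) (V : ℤ → Pt) : Prop where
  periodic : Function.Periodic V n
  pos : ∀ {i j k}, i < j → j < k → k < i + n → 0 < cw (V i) (V j) (V k)

/-- The reflected sequence, run through backwards, so that clockwise order is preserved. -/
def mirror (V : ℤ → Pt) (i : ℤ) : Pt := (-(V (-i)).1, (V (-i)).2)

theorem cw_mirror (V : ℤ → Pt) (i j k : ℤ) :
    cw (mirror V i) (mirror V j) (mirror V k) = cw (V (-k)) (V (-j)) (V (-i)) := by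
  simp only [cw, cross, mirror]; ring

theorem periodic_mirror {n : ℤ} {V : ℤ → Pt} (hV : Function.Periodic V n) :
    Function.Periodic (mirror V) n := fun i => by
  simp only [mirror, neg_add', hV.sub_eq]

namespace IsCyclicConvex

variable {n : ℤ} {V : ℤ → Pt}

theorem nonneg (h : IsCyclicConvex n V) {i j k : ℤ} (hij : i ≤ j) (hjk : j ≤ k) (hk : k ≤ i + n) :
    0 ≤ cw (V i) (V j) (V k) := by
  rcases hij.eq_or_lt with rfl | hij
  · rw [cw_self_left]
  rcases hjk.eq_or_lt with rfl | hjk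
  · rw [cw_self_right]
  rcases hk.eq_or_lt with rfl | hk
  · rw [h.periodic, cw_self_outer]
  · exact (h.pos hij hjk hk).le

theorem mirror (h : IsCyclicConvex n V) : IsCyclicConvex n (mirror V) where
  periodic := periodic_mirror h.periodic
  pos hij hjk hk := by
    rw [cw_mirror]
    exact h.pos (by omega) (by omega) (by omega)

theorem shift (h : IsCyclicConvex n V) (a : ℤ) : IsCyclicConvex n (fun i => V (a + i)) where
  periodic := h.periodic.const_add a
  pos hij hjk hk := h.pos (by omega) (by omega) (by omega)

variable {o₀ o₁ o₂ i₀ i₁ i₂ : ℤ}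

/-- The base `V o₂, V o₀` is moved to `V i₂, V i₀` one endpoint at a time. -/
theorem exchange (h : IsCyclicConvex n V) (h₁ : o₀ < i₀) (h₂ : i₀ < i₁) (h₃ : i₁ < o₁)
    (h₄ : o₁ < o₂) (h₅ : o₂ ≤ i₂) (h₆ : i₂ < i₀ + n) (h₇ : o₂ < o₀ + n)
    (hle : cw (V o₀) (V i₁) (V o₂) ≤ cw (V o₀) (V o₁) (V o₂)) :
    cw (V i₀) (V i₁) (V i₂) < cw (V i₀) (V o₁) (V i₂) := by
  have base_eq (o i : ℤ) (x : Pt) : cw (V o) x (V i) = cw (V (i - n)) (V o) x := by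
    rw [h.periodic.sub_eq, cw_rotate]
  rw [base_eq o₀ o₂, base_eq o₀ o₂] at hle
  rw [base_eq i₀ i₂, base_eq i₀ i₂]
  have moved_end := cw_lt_of_base_end (q' := V i₀) (h.pos (by omega) (by omega) (by omega))
    (h.nonneg (by omega) (by omega) (by omega)) (h.pos (by omega) (by omega) (by omega))
    (h.pos (by omega) (by omega) (by omega)) hle
  rcases h₅.eq_or_lt with rfl | h₅
  · exact moved_end
  · exact cw_lt_of_base_start (h.pos (by omega) (by omega) (by omega))
      (h.nonneg (by omega) (by omega) (by omega)) (h.pos (by omega) (by omega) (by omega))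
      (h.pos (by omega) (by omega) (by omega)) moved_end.le

theorem exchange' (h : IsCyclicConvex n V) (h₁ : o₀ < i₀) (h₂ : i₀ < i₁) (h₃ : i₁ < o₁)
    (h₄ : o₂ < o₀ + n) (h₅ : i₂ ≤ o₂) (h₆ : i₁ < i₂) (h₇ : o₁ < o₂)
    (hle : cw (V i₀) (V o₁) (V o₂) ≤ cw (V o₀) (V o₁) (V o₂)) :
    cw (V i₀) (V i₁) (V i₂) < cw (V o₀) (V i₁) (V i₂) := by
  have := h.mirror.exchange (o₀ := -o₁) (o₁ := -o₀) (o₂ := -o₂ + n) (i₀ := -i₁) (i₁ := -i₀)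
    (i₂ := -i₂ + n) (by omega) (by omega) (by omega) (by omega) (by omega) (by omega) (by omega)
  simp only [h.mirror.periodic _, cw_mirror, neg_neg, ← cw_rotate (V i₂),
    ← cw_rotate (V o₂)] at this
  exact this hle

end IsCyclicConvex

/-! ### Triangles that are optimal overall or for one of their vertices -/

/-- No triangle on the points of `V` is larger than that with indices `i, j, k`. -/
def IsMaxAll (V : ℤ → Pt) (i j k : ℤ) : Prop :=
  ∀ a b c, cw (V a) (V b) (V c) ≤ cw (V i) (V j) (V k)

/-- No triangle on the points of `V` with vertex `V r` is larger than that with indices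
`i, j, k`. -/
def IsMaxThrough (V : ℤ → Pt) (r i j k : ℤ) : Prop :=
  ∀ b c, cw (V r) (V b) (V c) ≤ cw (V i) (V j) (V k)

/-- The triangle with indices `i, j, k` is largest among those sharing a certain one of its
vertices. -/
def IsMaxRooted (V : ℤ → Pt) (i j k : ℤ) : Prop :=
  IsMaxThrough V i i j k ∨ IsMaxThrough V j i j k ∨ IsMaxThrough V k i j k

/-- One of the two triangles is largest among all, the other one among those with a common root. -/
def IsMaxPair (V : ℤ → Pt) (o₀ o₁ o₂ i₀ i₁ i₂ : ℤ) : Prop :=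
  IsMaxRooted V o₀ o₁ o₂ ∧ IsMaxAll V i₀ i₁ i₂ ∨ IsMaxAll V o₀ o₁ o₂ ∧ IsMaxRooted V i₀ i₁ i₂

section Optimal

variable {n : ℤ} {V : ℤ → Pt} {i j k : ℤ}

theorem IsMaxRooted.le_middle_or (h : IsMaxRooted V i j k) :
    (∀ x, cw (V i) (V x) (V k) ≤ cw (V i) (V j) (V k)) ∨ IsMaxThrough V j i j k := by
  rcases h with h | h | h
  · exact Or.inl fun x => h x k
  · exact Or.inr h
  · exact Or.inl fun x => cw_rotate (V k) _ _ ▸ h i x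

theorem IsMaxRooted.le_last_or (h : IsMaxRooted V i j k) :
    (∀ x, cw (V i) (V j) (V x) ≤ cw (V i) (V j) (V k)) ∨ IsMaxThrough V k i j k := by
  rcases h with h | h | h
  · exact Or.inl fun x => h j x
  · exact Or.inl fun x => cw_rotate (V i) _ _ ▸ h x i
  · exact Or.inr h

theorem IsMaxAll.rotate (hV : Function.Periodic V n) (h : IsMaxAll V i j k) :
    IsMaxAll V j k (i + n) := fun a b c => by
  rw [hV, cw_rotate (V i)]
  exact h a b c

theorem IsMaxAll.rotate' (hV : Function.Periodic V n) (h : IsMaxAll V i j k) :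
    IsMaxAll V (k - n) i j := fun a b c => by
  rw [hV.sub_eq, ← cw_rotate (V k)]
  exact h a b c

theorem IsMaxAll.mirror (hV : Function.Periodic V n) (h : IsMaxAll V i j k) :
    IsMaxAll (mirror V) (-j) (-i) (-k + n) := fun a b c => by
  simpa only [periodic_mirror hV _, cw_mirror, neg_neg, ← cw_rotate (V k)]
    using h (-c) (-b) (-a)

theorem IsMaxRooted.rotate (hV : Function.Periodic V n) (h : IsMaxRooted V i j k) :
    IsMaxRooted V j k (i + n) := by
  simp only [IsMaxRooted, IsMaxThrough, hV _, cw_rotate (V i)] at h ⊢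
  tauto

theorem IsMaxRooted.rotate' (hV : Function.Periodic V n) (h : IsMaxRooted V i j k) :
    IsMaxRooted V (k - n) i j := by
  simp only [IsMaxRooted, IsMaxThrough, hV.sub_eq, ← cw_rotate (V k) (V i)] at h ⊢
  tauto

theorem IsMaxThrough.mirror {r : ℤ} (hV : Function.Periodic V n) (h : IsMaxThrough V r i j k) :
    IsMaxThrough (mirror V) (-r) (-j) (-i) (-k + n) := fun b c => by
  simpa only [periodic_mirror hV _, cw_mirror, neg_neg, ← cw_rotate (V k) (V i), cw_rotate (V r)]
    using h (-c) (-b)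

theorem IsMaxRooted.mirror (hV : Function.Periodic V n) (h : IsMaxRooted V i j k) :
    IsMaxRooted (mirror V) (-j) (-i) (-k + n) := by
  rcases h with h | h | h
  · exact Or.inr (Or.inl (h.mirror hV))
  · exact Or.inl (h.mirror hV)
  · refine Or.inr (Or.inr fun b c => ?_)
    rw [periodic_mirror hV (-k)]
    exact periodic_mirror hV (-k) ▸ h.mirror hV b c

variable {o₀ o₁ o₂ i₀ i₁ i₂ : ℤ}

theorem IsMaxPair.symm (h : IsMaxPair V o₀ o₁ o₂ i₀ i₁ i₂) : IsMaxPair V i₀ i₁ i₂ o₀ o₁ o₂ :=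
  (Or.symm h).imp And.symm And.symm

theorem IsMaxPair.rotate (hV : Function.Periodic V n) (h : IsMaxPair V o₀ o₁ o₂ i₀ i₁ i₂) :
    IsMaxPair V o₁ o₂ (o₀ + n) i₀ i₁ i₂ :=
  h.imp (And.imp_left (·.rotate hV)) (And.imp_left (·.rotate hV))

theorem IsMaxPair.rotate' (hV : Function.Periodic V n) (h : IsMaxPair V o₀ o₁ o₂ i₀ i₁ i₂) :
    IsMaxPair V (o₂ - n) o₀ o₁ i₀ i₁ i₂ :=
  h.imp (And.imp_left (·.rotate' hV)) (And.imp_left (·.rotate' hV))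

theorem IsMaxPair.mirror (hV : Function.Periodic V n) (h : IsMaxPair V o₀ o₁ o₂ i₀ i₁ i₂) :
    IsMaxPair (mirror V) (-o₁) (-o₀) (-o₂ + n) (-i₁) (-i₀) (-i₂ + n) :=
  h.imp (And.imp (·.mirror hV) (·.mirror hV)) (And.imp (·.mirror hV) (·.mirror hV))

end Optimal

/-! ### Optimal triangles interleave -/

namespace IsCyclicConvex

variable {n : ℤ} {V : ℤ → Pt} {o₀ o₁ o₂ i₀ i₁ i₂ : ℤ}

theorem lt_of_isMaxAll (h : IsCyclicConvex n V) (hI : IsMaxAll V i₀ i₁ i₂) (h₁ : i₀ < i₁)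
    (h₂ : i₁ < o₁) (h₃ : o₁ < o₂) (h₄ : o₂ ≤ i₂) (h₅ : i₂ ≤ o₀) (h₆ : o₀ ≤ i₀ + n)
    (h₇ : i₂ < i₀ + n) (hne : o₂ < i₂ ∨ o₀ < i₀ + n) :
    cw (V o₀) (V o₁) (V o₂) < cw (V i₀) (V o₁) (V i₂) := by
  refine cw_lt_of_largest (h.pos h₁ (by omega) h₇) (h.pos (by omega) (by omega) (by omega))
    (h.pos (by omega) (by omega) (by omega)) (h.nonneg (by omega) (by omega) (by omega))
    (h.pos (by omega) (by omega) (by omega)) (h.nonneg (by omega) (by omega) (by omega))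
    ?_ (hI _ _ _) (hI _ _ _) (hI _ _ _) (hI _ _ _) ?_
  · rw [← h.periodic i₀]
    exact h.nonneg (by omega) (by omega) (by omega)
  · exact hne.imp (fun hne => h.pos (by omega) (by omega) (by omega))
      (fun hne => h.pos (by omega) (by omega) (by omega))

theorem lt_of_isMaxAll' (h : IsCyclicConvex n V) (hO : IsMaxAll V o₀ o₁ o₂) (h₁ : o₀ < i₀)
    (h₂ : i₀ < i₁) (h₃ : i₁ < o₁) (h₄ : o₁ < o₂) (h₅ : o₂ ≤ i₂) (h₆ : i₂ ≤ o₀ + n)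
    (h₇ : o₂ < o₀ + n) : cw (V i₀) (V i₁) (V i₂) < cw (V o₀) (V i₁) (V o₂) := by
  have := h.mirror.lt_of_isMaxAll (i₀ := -o₂) (i₁ := -o₁) (i₂ := -o₀) (o₀ := -i₂ + n) (o₁ := -i₁)
    (o₂ := -i₀) (fun a b c => by simpa only [cw_mirror, neg_neg] using hO (-c) (-b) (-a))
    (by omega) (by omega) (by omega) (by omega) (by omega) (by omega) (by omega) (by omega)
  simpa only [h.mirror.periodic _, cw_mirror, neg_neg] using this

theorem not_isMaxPair_right (h : IsCyclicConvex n V) (h₁ : o₀ < i₀) (h₂ : i₀ < i₁) (h₃ : i₁ < o₁)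
    (h₄ : o₁ < o₂) (h₅ : o₂ ≤ i₂) (h₆ : i₂ ≤ o₀ + n) (h₇ : o₂ < o₀ + n) :
    ¬ IsMaxPair V o₀ o₁ o₂ i₀ i₁ i₂ := by
  have ex := h.exchange h₁ h₂ h₃ h₄ h₅ (by omega) h₇
  rintro (⟨hO, hI⟩ | ⟨hO, hI⟩)
  · rcases hO.le_middle_or with hO | hO
    · exact (ex (hO _)).not_ge (hI _ _ _)
    · have hlt := h.lt_of_isMaxAll (o₀ := o₀ + n) hI h₂ h₃ h₄ h₅ h₆ (by omega) (by omega) (by omega)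
      rw [h.periodic, ← cw_rotate (V i₀)] at hlt
      exact hlt.not_ge (hO _ _)
  · rcases hI.le_middle_or with hI | hI
    · exact (ex (hO _ _ _)).not_ge (hI _)
    · have hlt := h.lt_of_isMaxAll' hO h₁ h₂ h₃ h₄ h₅ h₆ h₇
      rw [← cw_rotate (V o₀)] at hlt
      exact hlt.not_ge (hI _ _)

theorem not_isMaxPair_left (h : IsCyclicConvex n V) (h₁ : o₀ < i₀) (h₂ : i₀ < i₁) (h₃ : i₁ < o₁)
    (h₄ : o₁ < o₂) (h₅ : o₁ ≤ i₂) (h₆ : i₂ ≤ o₂) (h₇ : o₂ < o₀ + n) :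
    ¬ IsMaxPair V o₀ o₁ o₂ i₀ i₁ i₂ := fun hp =>
  h.mirror.not_isMaxPair_right (by omega) (by omega) (by omega) (by omega) (by omega) (by omega)
    (by omega) (hp.mirror h.periodic)

theorem not_isMaxPair_nested (h : IsCyclicConvex n V) (h₁ : o₀ < i₀) (h₂ : i₀ < i₁)
    (h₃ : i₁ < i₂) (h₄ : i₂ < o₁) (h₅ : o₁ < o₂) (h₆ : o₂ < o₀ + n) :
    ¬ IsMaxPair V o₀ o₁ o₂ i₀ i₁ i₂ := by
  have ex_last := h.exchange (i₀ := i₁) (i₁ := i₂) (i₂ := i₀ + n) (by omega) h₃ h₄ h₅ (by omega)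
    (by omega) h₆
  have ex_first := h.exchange' h₁ h₂ (h₃.trans h₄) h₆ (by omega) h₃ h₅
  rw [h.periodic, cw_rotate (V i₀), cw_rotate (V i₀)] at ex_last
  rintro (⟨hO, hI⟩ | ⟨hO, hI⟩)
  · rcases hO.le_middle_or with hO | hO
    · exact (ex_last (hO _)).not_ge (hI _ _ _)
    · exact (ex_first (cw_rotate (V i₀) _ _ ▸ hO _ _)).not_ge (hI _ _ _)
  · rcases hI.le_last_or with hI | hI
    · exact (ex_last (hO _ _ _)).not_ge (hI _)
    · exact (ex_first (hO _ _ _)).not_ge (cw_rotate (V i₂) (V o₀) _ ▸ hI _ _)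

theorem not_isMaxPair (h : IsCyclicConvex n V) (h₁ : o₀ < i₀) (h₂ : i₀ < i₁) (h₃ : i₁ < o₁)
    (h₄ : o₁ < o₂) (h₅ : o₂ < o₀ + n) (h₆ : i₁ < i₂) (h₇ : i₂ < i₀ + n) :
    ¬ IsMaxPair V o₀ o₁ o₂ i₀ i₁ i₂ := by
  rcases lt_or_ge i₂ o₁ with hi₂ | hi₂
  · exact h.not_isMaxPair_nested h₁ h₂ h₆ hi₂ h₄ h₅
  rcases le_or_gt i₂ o₂ with hi₂' | hi₂'
  · exact h.not_isMaxPair_left h₁ h₂ h₃ h₄ hi₂ hi₂' h₅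
  rcases le_or_gt i₂ (o₀ + n) with hi₂'' | hi₂''
  · exact h.not_isMaxPair_right h₁ h₂ h₃ h₄ hi₂'.le hi₂'' h₅
  · exact fun hp => h.not_isMaxPair_nested (i₀ := i₂ - n) (by omega) (by omega) h₂ h₃ h₄ h₅
      (hp.symm.rotate' h.periodic).symm

variable {u₀ u₁ u₂ v₀ v₁ v₂ : ℤ}

theorem exists_mem_arc (h : IsCyclicConvex n V) (hp : IsMaxPair V v₀ v₁ v₂ u₀ u₁ u₂)
    (hu₁ : u₀ < u₁) (hu₂ : u₁ < u₂) (hu : u₂ < u₀ + n) (hv₁ : v₀ < v₁) (hv₂ : v₁ < v₂)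
    (hv : v₂ < v₀ + n) (hlt : u₁ < v₀ + n) (hlt' : v₂ - n < u₀) :
    u₀ ≤ v₀ ∧ v₀ ≤ u₁ ∨ u₀ ≤ v₁ ∧ v₁ ≤ u₁ ∨ u₀ ≤ v₂ ∧ v₂ ≤ u₁ := by
  by_contra hc
  have hV := h.periodic
  rcases lt_or_ge u₁ v₀ with hv₀ | hv₀
  · exact h.not_isMaxPair hlt' hu₁ hv₀ hv₁ (by omega) hu₂ hu (hp.rotate' hV)
  rcases lt_or_ge u₁ v₁ with hv₁' | hv₁'
  · exact h.not_isMaxPair (by omega) hu₁ hv₁' hv₂ hv hu₂ hu hp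
  rcases lt_or_ge u₁ v₂ with hv₂' | hv₂'
  · exact h.not_isMaxPair (by omega) hu₁ hv₂' hv (by omega) hu₂ hu (hp.rotate hV)
  · exact h.not_isMaxPair (by omega) hu₁ hlt (by omega) (by omega) hu₂ hu ((hp.rotate hV).rotate hV)

end IsCyclicConvex

section Interleave

variable {n : ℤ} {V : ℤ → Pt} {u₀ u₁ u₂ v₀ v₁ v₂ : ℕ}

theorem separates_iff :
    Separates [v₀, v₁, v₂] [u₀, u₁, u₂] ↔
      (u₀ ≤ v₀ ∧ v₀ ≤ u₁ ∨ u₀ ≤ v₁ ∧ v₁ ≤ u₁ ∨ u₀ ≤ v₂ ∧ v₂ ≤ u₁) ∧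
      (u₁ ≤ v₀ ∧ v₀ ≤ u₂ ∨ u₁ ≤ v₁ ∧ v₁ ≤ u₂ ∨ u₁ ≤ v₂ ∧ v₂ ≤ u₂) ∧
      ((u₂ ≤ v₀ ∨ v₀ ≤ u₀) ∨ (u₂ ≤ v₁ ∨ v₁ ≤ u₀) ∨ (u₂ ≤ v₂ ∨ v₂ ≤ u₀)) := by
  simp only [Separates, List.getD_cons_zero, List.getD_cons_succ, List.mem_cons, List.not_mem_nil,
    or_false, exists_eq_or_imp, exists_eq_left]

theorem IsCyclicConvex.separates (h : IsCyclicConvex n V) (hp : IsMaxPair V v₀ v₁ v₂ u₀ u₁ u₂)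
    (hu₁ : u₀ < u₁) (hu₂ : u₁ < u₂) (hu : u₂ < n) (hv₁ : v₀ < v₁) (hv₂ : v₁ < v₂) (hv : v₂ < n) :
    Separates [v₀, v₁, v₂] [u₀, u₁, u₂] := by
  have hp' := (hp.symm.rotate h.periodic).symm
  have hp'' := (hp'.symm.rotate h.periodic).symm
  have arc₀ := h.exists_mem_arc hp (by omega) (by omega) (by omega) (by omega) (by omega) (by omega)
    (by omega) (by omega)
  have arc₁ := h.exists_mem_arc hp' (by omega) (by omega) (by omega) (by omega) (by omega)
    (by omega) (by omega) (by omega)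
  refine separates_iff.2 ⟨by omega, by omega, ?_⟩
  by_contra hc
  have arc₂ := h.exists_mem_arc hp'' (by omega) (by omega) (by omega) (by omega) (by omega)
    (by omega) (by omega) (by omega)
  omega

theorem IsCyclicConvex.interleave (h : IsCyclicConvex n V) (hr : IsMaxRooted V u₀ u₁ u₂)
    (ha : IsMaxAll V v₀ v₁ v₂) (hu₁ : u₀ < u₁) (hu₂ : u₁ < u₂) (hu : u₂ < n) (hv₁ : v₀ < v₁)
    (hv₂ : v₁ < v₂) (hv : v₂ < n) : Interleave [u₀, u₁, u₂] [v₀, v₁, v₂] :=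
  ⟨h.separates (Or.inr ⟨ha, hr⟩) hu₁ hu₂ hu hv₁ hv₂ hv,
    h.separates (Or.inl ⟨hr, ha⟩) hv₁ hv₂ hv hu₁ hu₂ hu⟩

theorem interleave_iff (hu₁ : u₀ < u₁) (hu₂ : u₁ < u₂) (hv₁ : v₀ < v₁) (hv₂ : v₁ < v₂) :
    Interleave [u₀, u₁, u₂] [v₀, v₁, v₂] ↔
      u₀ ≤ v₀ ∧ v₀ ≤ u₁ ∧ u₁ ≤ v₁ ∧ v₁ ≤ u₂ ∧ u₂ ≤ v₂ ∨
      v₀ ≤ u₀ ∧ u₀ ≤ v₁ ∧ v₁ ≤ u₁ ∧ u₁ ≤ v₂ ∧ v₂ ≤ u₂ := by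
  rw [Interleave, separates_iff, separates_iff]
  constructor
  · rintro ⟨⟨arc₀, arc₁, arc₂⟩, arc₃, arc₄, arc₅⟩
    rcases arc₀ with h | h | h <;> rcases arc₁ with h' | h' | h' <;> omega
  · rintro (h | h) <;> omega

end Interleave

/-! ### Merging two triples -/

section Merge

variable {a₀ a₁ a₂ m₀ m₁ m₂ t₀ t₁ t₂ i m g : ℕ} {u v l : List ℕ} {X : ℕ → ℕ}

theorem insertionSort_eq_of_perm {l' : List ℕ} (hp : l.Perm l') (hl : l'.Pairwise (· ≤ ·)) :
    l.insertionSort (· ≤ ·) = l' :=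
  List.Perm.eq_of_pairwise' (List.pairwise_insertionSort _ _) hl
    ((List.perm_insertionSort _ l).trans hp)

/-- The sorted concatenation of `u` and `v`, as a function of the position. -/
def mergedOffset (u v : List ℕ) (i : ℕ) : ℕ :=
  (List.insertionSort (· ≤ ·) (u ++ v)).getD i 0

/-- `X 0 ≤ ⋯ ≤ X 5` are the offsets `aᵢ` and `mᵢ`, in an order in which `aᵢ` and `mᵢ` are
adjacent. -/
def IsEvenMerge (a₀ a₁ a₂ m₀ m₁ m₂ : ℕ) (X : ℕ → ℕ) : Prop :=
  (X 0 = min a₀ m₀ ∧ X 1 = max a₀ m₀ ∧ X 2 = min a₁ m₁ ∧ X 3 = max a₁ m₁ ∧ X 4 = min a₂ m₂ ∧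
    X 5 = max a₂ m₂) ∧ X 1 ≤ X 2 ∧ X 3 ≤ X 4

/-- `X 0 ≤ ⋯ ≤ X 5` are the offsets `aᵢ` and `mᵢ`, in an order in which `aᵢ₊₁` and `mᵢ` are
adjacent. -/
def IsOddMerge (a₀ a₁ a₂ m₀ m₁ m₂ : ℕ) (X : ℕ → ℕ) : Prop :=
  (X 0 = a₀ ∧ X 1 = min a₁ m₀ ∧ X 2 = max a₁ m₀ ∧ X 3 = min a₂ m₁ ∧ X 4 = max a₂ m₁ ∧
    X 5 = m₂) ∧ X 0 ≤ X 1 ∧ X 2 ≤ X 3 ∧ X 4 ≤ X 5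

/-- The order of the offsets `aᵢ` and `mᵢ`, listed as `X 0 ≤ ⋯ ≤ X 5`, is one of those that are
possible if some triangle interleaves with both triples. -/
def IsMerge (a₀ a₁ a₂ m₀ m₁ m₂ : ℕ) (X : ℕ → ℕ) : Prop :=
  IsEvenMerge a₀ a₁ a₂ m₀ m₁ m₂ X ∨
    IsOddMerge a₀ a₁ a₂ m₀ m₁ m₂ X ∨ IsOddMerge m₀ m₁ m₂ a₀ a₁ a₂ X

/-- The offset `i` belongs to the first candidate, made up of the intervals `[X 0, X 1]`,
`[X 2, X 3]`, `[X 4, X 5]`. -/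
def KeepFirst (X : ℕ → ℕ) (i : ℕ) : Prop :=
  X 0 ≤ i ∧ i ≤ X 1 ∨ X 2 ≤ i ∧ i ≤ X 3 ∨ X 4 ≤ i ∧ i ≤ X 5

/-- The offset `i` belongs to the second candidate, made up of the intervals `[X 1, X 2]`,
`[X 3, X 4]`, `[X 5, X 0]`, the last of which passes through the offset `0`. -/
def KeepSecond (X : ℕ → ℕ) (i : ℕ) : Prop :=
  X 1 ≤ i ∧ i ≤ X 2 ∨ X 3 ≤ i ∧ i ≤ X 4 ∨ X 5 ≤ i ∨ i ≤ X 0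

/-- The criterion by which the first candidate is chosen if the dividing triangles do not
interleave. -/
def FirstMixed (u v : List ℕ) (X : ℕ → ℕ) : Prop :=
  Mixed u v (X 1) (X 2) ∧ Mixed u v (X 3) (X 4) ∧ Mixed u v (X 5) (X 0)

/-- The offset `m` is at distance at least `g` from `x`. -/
def Far (m g x : ℕ) : Prop := x + g ≤ m ∨ m + g ≤ x

/-- One of the two gaps of length `g` next to `m` contains no offset satisfying `keep`. -/
def AvoidsGap (m g : ℕ) (keep : ℕ → Prop) : Prop :=
  (∀ i, m < i + g → i < m → ¬ keep i) ∨ (∀ i, m < i → i < m + g → ¬ keep i)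

theorem mergedOffset_eq_of_perm (hp : (u ++ v).Perm l) (hl : l.Pairwise (· ≤ ·)) :
    mergedOffset u v = fun i => l.getD i 0 := by
  unfold mergedOffset
  rw [insertionSort_eq_of_perm hp hl]

theorem mergedOffset_comm (u v : List ℕ) : mergedOffset u v = mergedOffset v u :=
  mergedOffset_eq_of_perm (List.perm_append_comm.trans (List.perm_insertionSort _ _).symm)
    (List.pairwise_insertionSort _ _)

theorem isEvenMerge_mergedOffset (h₁ : max a₀ m₀ ≤ min a₁ m₁) (h₂ : max a₁ m₁ ≤ min a₂ m₂) :
    IsEvenMerge a₀ a₁ a₂ m₀ m₁ m₂ (mergedOffset [a₀, a₁, a₂] [m₀, m₁, m₂]) := by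
  rw [mergedOffset_eq_of_perm
    (l := [min a₀ m₀, max a₀ m₀, min a₁ m₁, max a₁ m₁, min a₂ m₂, max a₂ m₂]) (by grind) (by grind)]
  exact ⟨⟨rfl, rfl, rfl, rfl, rfl, rfl⟩, h₁, h₂⟩

theorem isOddMerge_mergedOffset (h₁ : a₀ ≤ min a₁ m₀) (h₂ : max a₁ m₀ ≤ min a₂ m₁)
    (h₃ : max a₂ m₁ ≤ m₂) :
    IsOddMerge a₀ a₁ a₂ m₀ m₁ m₂ (mergedOffset [a₀, a₁, a₂] [m₀, m₁, m₂]) := by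
  rw [mergedOffset_eq_of_perm
    (l := [a₀, min a₁ m₀, max a₁ m₀, min a₂ m₁, max a₂ m₁, m₂]) (by grind) (by grind)]
  exact ⟨⟨rfl, rfl, rfl, rfl, rfl, rfl⟩, h₁, h₂, h₃⟩

theorem firstMixed_comm : FirstMixed u v X ↔ FirstMixed v u X := by
  simp only [FirstMixed, Mixed, and_comm]

theorem IsOddMerge.firstMixed (h : IsOddMerge a₀ a₁ a₂ m₀ m₁ m₂ X) :
    FirstMixed [a₀, a₁, a₂] [m₀, m₁, m₂] X := by
  simp only [IsOddMerge, FirstMixed, Mixed, List.mem_cons, List.not_mem_nil, or_false] at *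
  omega

theorem IsMerge.keep (h : IsMerge a₀ a₁ a₂ m₀ m₁ m₂ X) (hi : i ∈ [a₀, a₁, a₂]) :
    KeepFirst X i ∧ KeepSecond X i := by
  simp only [IsMerge, IsEvenMerge, IsOddMerge, KeepFirst, KeepSecond, List.mem_cons,
    List.not_mem_nil, or_false] at *
  rcases h with h | h | h <;> omega

theorem IsMerge.increasing (h : IsMerge a₀ a₁ a₂ m₀ m₁ m₂ X) :
    X 0 ≤ X 1 ∧ X 1 ≤ X 2 ∧ X 2 ≤ X 3 ∧ X 3 ≤ X 4 ∧ X 4 ≤ X 5 := by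
  simp only [IsMerge, IsEvenMerge, IsOddMerge] at h
  rcases h with h | h | h <;> omega

theorem IsEvenMerge.interleave_of_firstMixed (h : IsEvenMerge a₀ a₁ a₂ m₀ m₁ m₂ X)
    (ha₁ : a₀ < a₁) (ha₂ : a₁ < a₂) (hm₁ : m₀ < m₁) (hm₂ : m₁ < m₂)
    (hF : FirstMixed [a₀, a₁, a₂] [m₀, m₁, m₂] X) : Interleave [a₀, a₁, a₂] [m₀, m₁, m₂] := by
  obtain ⟨⟨x₀, x₁, x₂, x₃, x₄, x₅⟩, h₁, h₂⟩ := h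
  simp only [FirstMixed, Mixed, List.mem_cons, List.not_mem_nil, or_false] at hF
  obtain ⟨mixed₁, mixed₂, mixed₃⟩ := hF
  have same_order₁ : a₀ ≤ m₀ ∧ a₁ ≤ m₁ ∨ m₀ ≤ a₀ ∧ m₁ ≤ a₁ := by clear mixed₂ mixed₃; omega
  have same_order₂ : a₁ ≤ m₁ ∧ a₂ ≤ m₂ ∨ m₁ ≤ a₁ ∧ m₂ ≤ a₂ := by clear mixed₁ mixed₃; omega
  have same_order₃ : a₀ ≤ m₀ ∧ a₂ ≤ m₂ ∨ m₀ ≤ a₀ ∧ m₂ ≤ a₂ := by clear mixed₁ mixed₂; omega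
  rw [interleave_iff ha₁ ha₂ hm₁ hm₂]
  clear mixed₁ mixed₂ mixed₃
  omega

theorem isMerge_and_keep_of_interleave (ha₁ : a₀ < a₁) (ha₂ : a₁ < a₂) (hm₁ : m₀ < m₁)
    (hm₂ : m₁ < m₂) (ht₁ : t₀ < t₁) (ht₂ : t₁ < t₂)
    (hA : Interleave [a₀, a₁, a₂] [t₀, t₁, t₂]) (hM : Interleave [m₀, m₁, m₂] [t₀, t₁, t₂])
    (hX : X = mergedOffset [a₀, a₁, a₂] [m₀, m₁, m₂]) :
    IsMerge a₀ a₁ a₂ m₀ m₁ m₂ X ∧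
      ((Interleave [a₀, a₁, a₂] [m₀, m₁, m₂] ∨ FirstMixed [a₀, a₁, a₂] [m₀, m₁, m₂] X) ∧
          (KeepFirst X t₀ ∧ KeepFirst X t₁ ∧ KeepFirst X t₂) ∨
        (Interleave [a₀, a₁, a₂] [m₀, m₁, m₂] ∨ ¬ FirstMixed [a₀, a₁, a₂] [m₀, m₁, m₂] X) ∧
          KeepSecond X t₀ ∧ KeepSecond X t₁ ∧ KeepSecond X t₂) := by
  have keepSecond_of_even (h : IsEvenMerge a₀ a₁ a₂ m₀ m₁ m₂ X)
      (hk : KeepSecond X t₀ ∧ KeepSecond X t₁ ∧ KeepSecond X t₂) := And.intro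
    (or_not_of_imp (h.interleave_of_firstMixed ha₁ ha₂ hm₁ hm₂)) hk
  rw [interleave_iff ha₁ ha₂ ht₁ ht₂] at hA
  rw [interleave_iff hm₁ hm₂ ht₁ ht₂] at hM
  rcases hA with hA | hA <;> rcases hM with hM | hM
  · have h : IsEvenMerge a₀ a₁ a₂ m₀ m₁ m₂ X :=
      hX ▸ isEvenMerge_mergedOffset (by omega) (by omega)
    refine ⟨Or.inl h, Or.inr (keepSecond_of_even h ?_)⟩
    simp only [IsEvenMerge, KeepSecond] at h ⊢
    omega
  · have h : IsOddMerge a₀ a₁ a₂ m₀ m₁ m₂ X :=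
      hX ▸ isOddMerge_mergedOffset (by omega) (by omega) (by omega)
    refine ⟨Or.inr (Or.inl h), Or.inl ⟨Or.inr h.firstMixed, ?_⟩⟩
    simp only [IsOddMerge, KeepFirst] at h ⊢
    omega
  · have h : IsOddMerge m₀ m₁ m₂ a₀ a₁ a₂ X :=
      (hX.trans (mergedOffset_comm _ _)) ▸
        isOddMerge_mergedOffset (by omega) (by omega) (by omega)
    refine ⟨Or.inr (Or.inr h), Or.inl ⟨Or.inr (firstMixed_comm.1 h.firstMixed), ?_⟩⟩
    simp only [IsOddMerge, KeepFirst] at h ⊢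
    omega
  · have h : IsEvenMerge a₀ a₁ a₂ m₀ m₁ m₂ X :=
      hX ▸ isEvenMerge_mergedOffset (by omega) (by omega)
    refine ⟨Or.inl h, Or.inr (keepSecond_of_even h ?_)⟩
    simp only [IsEvenMerge, KeepSecond] at h ⊢
    omega

theorem IsMerge.alternating (h : IsMerge a₀ a₁ a₂ m₀ m₁ m₂ X) (ha₁ : a₀ < a₁) (ha₂ : a₁ < a₂)
    (hm₁ : m₀ < m₁) (hm₂ : m₁ < m₂) (hI : Interleave [a₀, a₁, a₂] [m₀, m₁, m₂]) :
    (X 0 = a₀ ∧ X 1 = m₀ ∧ X 2 = a₁ ∧ X 3 = m₁ ∧ X 4 = a₂ ∧ X 5 = m₂) ∨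
      X 0 = m₀ ∧ X 1 = a₀ ∧ X 2 = m₁ ∧ X 3 = a₁ ∧ X 4 = m₂ ∧ X 5 = a₂ := by
  rw [interleave_iff ha₁ ha₂ hm₁ hm₂] at hI
  simp only [IsMerge, IsEvenMerge, IsOddMerge] at *
  rcases hI with hI | hI <;> rcases h with h | h | h <;> omega

theorem IsEvenMerge.avoidsGap (h : IsEvenMerge a₀ a₁ a₂ m₀ m₁ m₂ X) (hm : m ∈ [m₀, m₁, m₂])
    (hfar : ∀ a ∈ [a₀, a₁, a₂], Far m g a) : AvoidsGap m g (KeepSecond X) := by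
  obtain ⟨⟨x₀, x₁, x₂, x₃, x₄, x₅⟩, h₁, h₂⟩ := h
  simp only [List.mem_cons, List.not_mem_nil, or_false, forall_eq_or_imp, forall_eq] at hm hfar
  obtain ⟨far₀, far₁, far₂⟩ := hfar
  unfold Far at far₀ far₁ far₂
  rcases hm with rfl | rfl | rfl
  · rcases le_total a₀ m with h | h
    · exact Or.inl fun i _ _ => by unfold KeepSecond; omega
    · exact Or.inr fun i _ _ => by unfold KeepSecond; omega
  · rcases le_total a₁ m with h | h
    · exact Or.inl fun i _ _ => by unfold KeepSecond; omega
    · exact Or.inr fun i _ _ => by unfold KeepSecond; omega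
  · rcases le_total a₂ m with h | h
    · exact Or.inl fun i _ _ => by unfold KeepSecond; omega
    · exact Or.inr fun i _ _ => by unfold KeepSecond; omega

theorem IsOddMerge.avoidsGap (h : IsOddMerge a₀ a₁ a₂ m₀ m₁ m₂ X) (hm : m ∈ [m₀, m₁, m₂])
    (hfar : ∀ a ∈ [a₀, a₁, a₂], Far m g a) : AvoidsGap m g (KeepFirst X) := by
  obtain ⟨⟨x₀, x₁, x₂, x₃, x₄, x₅⟩, h₁, h₂, h₃⟩ := h
  simp only [List.mem_cons, List.not_mem_nil, or_false, forall_eq_or_imp, forall_eq, Far] at hm hfar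
  obtain ⟨far₀, far₁, far₂⟩ := hfar
  rcases hm with rfl | rfl | rfl
  · rcases le_total a₁ m with h | h
    · exact Or.inl fun i _ _ => by unfold KeepFirst; omega
    · exact Or.inr fun i _ _ => by unfold KeepFirst; omega
  · rcases le_total a₂ m with h | h
    · exact Or.inl fun i _ _ => by unfold KeepFirst; omega
    · exact Or.inr fun i _ _ => by unfold KeepFirst; omega
  · exact Or.inr fun i _ _ => by unfold KeepFirst; omega

theorem IsOddMerge.avoidsGap' (h : IsOddMerge m₀ m₁ m₂ a₀ a₁ a₂ X) (hm : m ∈ [m₀, m₁, m₂])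
    (hfar : ∀ a ∈ [a₀, a₁, a₂], Far m g a) : AvoidsGap m g (KeepFirst X) := by
  obtain ⟨⟨x₀, x₁, x₂, x₃, x₄, x₅⟩, h₁, h₂, h₃⟩ := h
  simp only [List.mem_cons, List.not_mem_nil, or_false, forall_eq_or_imp, forall_eq, Far] at hm hfar
  obtain ⟨far₀, far₁, far₂⟩ := hfar
  rcases hm with rfl | rfl | rfl
  · exact Or.inl fun i _ _ => by unfold KeepFirst; omega
  · rcases le_total a₀ m with h | h
    · exact Or.inl fun i _ _ => by unfold KeepFirst; omega
    · exact Or.inr fun i _ _ => by unfold KeepFirst; omega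
  · rcases le_total a₁ m with h | h
    · exact Or.inl fun i _ _ => by unfold KeepFirst; omega
    · exact Or.inr fun i _ _ => by unfold KeepFirst; omega

theorem IsMerge.avoidsGap_of_interleave (h : IsMerge a₀ a₁ a₂ m₀ m₁ m₂ X) (ha₁ : a₀ < a₁)
    (ha₂ : a₁ < a₂) (hm₁ : m₀ < m₁) (hm₂ : m₁ < m₂)
    (hI : Interleave [a₀, a₁, a₂] [m₀, m₁, m₂]) (hm : m ∈ [m₀, m₁, m₂])
    (hfar : ∀ a ∈ [a₀, a₁, a₂], Far m g a) :
    AvoidsGap m g (KeepFirst X) ∧ AvoidsGap m g (KeepSecond X) := by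
  simp only [List.mem_cons, List.not_mem_nil, or_false, forall_eq_or_imp, forall_eq, Far] at hm hfar
  have hinc := h.increasing
  rcases h.alternating ha₁ ha₂ hm₁ hm₂ hI with hX | hX
  · exact ⟨Or.inr fun i _ _ => by unfold KeepFirst; omega,
      Or.inl fun i _ _ => by unfold KeepSecond; omega⟩
  · exact ⟨Or.inl fun i _ _ => by unfold KeepFirst; omega,
      Or.inr fun i _ _ => by unfold KeepSecond; omega⟩

theorem IsMerge.avoidsGap_keepFirst (h : IsMerge a₀ a₁ a₂ m₀ m₁ m₂ X) (ha₁ : a₀ < a₁)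
    (ha₂ : a₁ < a₂) (hm₁ : m₀ < m₁) (hm₂ : m₁ < m₂)
    (hIF : Interleave [a₀, a₁, a₂] [m₀, m₁, m₂] ∨ FirstMixed [a₀, a₁, a₂] [m₀, m₁, m₂] X)
    (hm : m ∈ [m₀, m₁, m₂]) (hfar : ∀ a ∈ [a₀, a₁, a₂], Far m g a) :
    AvoidsGap m g (KeepFirst X) := by
  rcases h with even | odd | odd
  · have hI := hIF.elim id (even.interleave_of_firstMixed ha₁ ha₂ hm₁ hm₂)
    exact (avoidsGap_of_interleave (Or.inl even) ha₁ ha₂ hm₁ hm₂ hI hm hfar).1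
  · exact odd.avoidsGap hm hfar
  · exact odd.avoidsGap' hm hfar

theorem IsMerge.avoidsGap_keepSecond (h : IsMerge a₀ a₁ a₂ m₀ m₁ m₂ X) (ha₁ : a₀ < a₁)
    (ha₂ : a₁ < a₂) (hm₁ : m₀ < m₁) (hm₂ : m₁ < m₂)
    (hIF : Interleave [a₀, a₁, a₂] [m₀, m₁, m₂] ∨ ¬ FirstMixed [a₀, a₁, a₂] [m₀, m₁, m₂] X)
    (hm : m ∈ [m₀, m₁, m₂]) (hfar : ∀ a ∈ [a₀, a₁, a₂], Far m g a) :
    AvoidsGap m g (KeepSecond X) := by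
  rcases h with even | odd
  · exact even.avoidsGap hm hfar
  · have hF : FirstMixed [a₀, a₁, a₂] [m₀, m₁, m₂] X :=
      odd.elim (·.firstMixed) fun odd => firstMixed_comm.1 odd.firstMixed
    have hI := hIF.resolve_right (not_not_intro hF)
    exact (avoidsGap_of_interleave (Or.inr odd) ha₁ ha₂ hm₁ hm₂ hI hm hfar).2

end Merge

/-! ### Polygons as cyclic sequences -/

/-- The vertices of `P`, indexed cyclically by the integers. -/
def cyc (P : Array Pt) (z : ℤ) : Pt := vtx P (z % (P.size : ℤ)).toNat

/-- The vertices of `P`, indexed cyclically by their offset from `r`. -/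
def offs (P : Array Pt) (r : ℕ) (z : ℤ) : Pt := cyc P (r + z)

section Cyclic

variable {P : Array Pt}

theorem cyc_natCast (P : Array Pt) (i : ℕ) : cyc P i = vtx P i := by
  rw [cyc, ← Int.natCast_mod, Int.toNat_natCast, vtx, vtx, Nat.mod_mod]

theorem periodic_cyc (P : Array Pt) : Function.Periodic (cyc P) P.size := fun z => by
  rw [cyc, cyc, Int.add_emod_right]

theorem offs_natCast (P : Array Pt) (r i : ℕ) : offs P r i = vtx P (r + i) := by
  rw [offs, ← Nat.cast_add, cyc_natCast]

theorem vtx_mem (hP : 0 < P.size) (i : ℕ) : vtx P i ∈ P := by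
  simp [vtx, Array.getD, Nat.mod_lt i hP]

theorem offs_mem (hP : 0 < P.size) (r : ℕ) (z : ℤ) : offs P r z ∈ P :=
  vtx_mem hP _

theorem exists_vtx_eq {p : Pt} (hp : p ∈ P) : ∃ j, j < P.size ∧ vtx P j = p := by
  obtain ⟨j, hj, rfl⟩ := Array.mem_iff_getElem.1 hp
  exact ⟨j, hj, by simp [vtx, Array.getD, Nat.mod_eq_of_lt hj, hj]⟩

theorem exists_offs_eq {p : Pt} (hp : p ∈ P) (r : ℕ) : ∃ i < P.size, p = offs P r i := by
  obtain ⟨j, hj, rfl⟩ := exists_vtx_eq hp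
  have nonneg := Int.emod_nonneg (j - r) (show (P.size : ℤ) ≠ 0 by omega)
  have lt_size := Int.emod_lt_of_pos (j - r) (show (0 : ℤ) < P.size by omega)
  refine ⟨((j - r) % (P.size : ℤ)).toNat, by omega, ?_⟩
  rw [offs, Int.toNat_of_nonneg nonneg, cyc, Int.add_emod_emod, add_sub_cancel, ← cyc,
    cyc_natCast]

theorem IsConvexPolygon.size_pos (h : IsConvexPolygon P) : 0 < P.size :=
  three_pos.trans_le h.1

theorem IsConvexPolygon.cw_cyc_pos (h : IsConvexPolygon P) {i j k : ℤ} (hi : 0 ≤ i) (hij : i < j)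
    (hjk : j < k) (hk : k < P.size) : 0 < cw (cyc P i) (cyc P j) (cyc P k) := by
  lift i to ℕ using hi
  lift j to ℕ using by omega
  lift k to ℕ using by omega
  simp only [cyc_natCast, cw]
  exact neg_pos.2 (h.2 i j k (by omega) (by omega) (by omega))

theorem IsConvexPolygon.cw_cyc_pos_of_lt_add (h : IsConvexPolygon P) {i j k : ℤ} (hi : 0 ≤ i)
    (hin : i < P.size) (hij : i < j) (hjk : j < k) (hk : k < i + P.size) :
    0 < cw (cyc P i) (cyc P j) (cyc P k) := by
  rcases lt_or_ge k P.size with hkn | hkn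
  · exact h.cw_cyc_pos hi hij hjk hkn
  rw [← (periodic_cyc P).sub_eq k]
  rcases lt_or_ge j P.size with hjn | hjn
  · rw [cw_rotate]
    exact h.cw_cyc_pos (by omega) (by omega) hij hjn
  · rw [← (periodic_cyc P).sub_eq j, ← cw_rotate]
    exact h.cw_cyc_pos (by omega) (by omega) (by omega) hin

theorem IsConvexPolygon.isCyclicConvex (h : IsConvexPolygon P) :
    IsCyclicConvex P.size (cyc P) where
  periodic := periodic_cyc P
  pos {i j k} hij hjk hk := by
    have hpos : (0 : ℤ) < P.size := mod_cast h.size_pos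
    have hmod := Int.emod_def i P.size
    have nonneg := Int.emod_nonneg i hpos.ne'
    have lt_size := Int.emod_lt_of_pos i hpos
    have shift (z : ℤ) : cyc P z = cyc P (z - P.size * (i / P.size)) := by
      rw [mul_comm]
      exact ((periodic_cyc P).sub_int_mul_eq (i / P.size)).symm
    rw [shift i, shift j, shift k]
    exact h.cw_cyc_pos_of_lt_add (by omega) (by omega) (by omega) (by omega) (by omega)

theorem IsConvexPolygon.isCyclicConvex_offs (h : IsConvexPolygon P) (r : ℕ) :
    IsCyclicConvex P.size (offs P r) :=
  h.isCyclicConvex.shift r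

end Cyclic

/-! ### The sweep -/

namespace Timed

variable {α β : Type}

@[simp] theorem val_bind (x : Timed α) (f : α → Timed β) : (x >>= f).val = (f x.val).val := rfl

@[simp] theorem time_bind (x : Timed α) (f : α → Timed β) :
    (x >>= f).time = x.time + (f x.val).time := rfl

@[simp] theorem val_pure (a : α) : (pure a : Timed α).val = a := rfl

@[simp] theorem time_pure (a : α) : (pure a : Timed α).time = 0 := rfl

@[simp] theorem val_ops (k : ℕ) (a : α) : (ops k a).val = a := rfl

@[simp] theorem time_ops (k : ℕ) (a : α) : (ops k a).time = k := rfl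

end Timed

/-- Twice the area of the triangle with offsets `0 < b < c` from `r`. -/
def rootedArea (P : Array Pt) (r b c : ℕ) : ℝ := cw (offs P r 0) (offs P r b) (offs P r c)

/-- The area does not decrease while the third vertex moves from `b + 1` to `c`. -/
def Ascending (P : Array Pt) (r b c : ℕ) : Prop :=
  ∀ j, b < j → j < c → rootedArea P r b j ≤ rootedArea P r b (j + 1)

/-- The offsets from a root, in increasing order, of the other two vertices of a triangle. -/
def ValidOffsets (P : Array Pt) (o : ℕ × ℕ) : Prop := 0 < o.1 ∧ o.1 < o.2 ∧ o.2 < P.size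

/-- No triangle rooted at `r` whose second vertex precedes `b` is larger than that with the
offsets `best`. -/
def IsBestBefore (P : Array Pt) (r b : ℕ) (best : ℕ × ℕ) : Prop :=
  ValidOffsets P best ∧ ∀ i k, 0 < i → i < b → i < k → k < P.size →
    rootedArea P r i k ≤ rootedArea P r best.1 best.2

section Sweep

variable {P : Array Pt} {r b c : ℕ} {best : ℕ × ℕ}

theorem climb_bounds (hc : c < P.size) :
    c ≤ (climb P r b c).val ∧ (climb P r b c).val < P.size ∧
      (climb P r b c).time + 50 * c ≤ 50 * (climb P r b c).val + 50 := by
  fun_induction climb P r b c with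
  | case1 c hn ih =>
    specialize ih hn
    by_cases hup : area (triAt P r b c) ≤ area (triAt P r b (c + 1)) <;>
      simp only [Timed.val_bind, Timed.time_bind, Timed.val_ops, Timed.time_ops, hup, decide_true,
        decide_false, Bool.false_eq_true, if_true, if_false, Timed.val_pure, Timed.time_pure] <;>
      omega
  | case2 c hn =>
    simp only [Timed.val_ops, Timed.time_ops]
    omega

theorem sweep_time (hc : c < P.size) :
    (sweep P r b c best).time ≤ 154 * (P.size - b) + 50 * (P.size - c) + 2 := by
  fun_induction sweep P r b c best with
  | case1 b c best hn ih =>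
    obtain ⟨_, climb_lt, climb_time⟩ :=
      climb_bounds (r := r) (b := b) (show max c (b + 1) < P.size by omega)
    simp only [Timed.time_bind, Timed.val_ops, Timed.time_ops]
    refine (Nat.add_le_add_left (Nat.add_le_add_left (Nat.add_le_add_left
      (ih _ _ climb_lt) _) _) _).trans ?_
    omega
  | case2 =>
    simp only [Timed.time_ops]
    omega

theorem rootedOffsets_time (hP : 3 ≤ P.size) (r : ℕ) :
    (rootedOffsets P r).time ≤ 204 * P.size :=
  (sweep_time (by omega)).trans (by omega)

theorem area_triAt (h : IsConvexPolygon P) (hbc : b ≤ c) (hc : c ≤ P.size) :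
    area (triAt P r b c) = rootedArea P r b c / 2 := by
  have nonneg : 0 ≤ rootedArea P r b c :=
    (h.isCyclicConvex_offs r).nonneg (by omega) (by omega) (by omega)
  have root_eq : offs P r 0 = vtx P r := offs_natCast P r 0
  rw [rootedArea, root_eq, offs_natCast, offs_natCast] at nonneg ⊢
  rw [triAt, area_eq_abs_cw, abs_of_nonneg nonneg]

theorem rootedArea_le_succ (h : IsConvexPolygon P) {b' : ℕ} (h0 : 0 < b) (hb : b < b')
    (hb' : b' ≤ c) (hc : c + 1 < P.size)
    (hle : rootedArea P r b c ≤ rootedArea P r b (c + 1)) :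
    rootedArea P r b' c ≤ rootedArea P r b' (c + 1) := by
  have hV := h.isCyclicConvex_offs r
  exact (cw_lt_of_base_end (hV.pos (by omega) (by omega) (by omega))
    (hV.nonneg (by omega) (by omega) (by omega)) (hV.pos (by omega) (by omega) (by omega))
    (hV.pos (by omega) (by omega) (by omega)) hle).le

theorem rootedArea_succ_lt (h : IsConvexPolygon P) (h0 : 0 < b) (hb : b < c)
    (hc : c + 2 < P.size) (hlt : rootedArea P r b (c + 1) < rootedArea P r b c) :
    rootedArea P r b (c + 2) < rootedArea P r b (c + 1) := by
  have hV := h.isCyclicConvex_offs r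
  exact cw_unimodal (hV.pos (by omega) (by omega) (by omega))
    (hV.pos (by omega) (by omega) (by omega)).le (hV.pos (by omega) (by omega) (by omega))
    (hV.pos (by omega) (by omega) (by omega)) hlt.le

theorem Ascending.le (hA : Ascending P r b c) {k : ℕ} (hbk : b < k) (hkc : k ≤ c) :
    rootedArea P r b k ≤ rootedArea P r b c := by
  induction c, hkc using Nat.le_induction with
  | base => exact le_rfl
  | succ c hkc ih =>
    exact (ih fun j hj hjc => hA j hj (by omega)).trans (hA c (by omega) (by omega))

theorem rootedArea_le_of_descent (h : IsConvexPolygon P) (h0 : 0 < b) (hbc : b < c)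
    (hlast : c + 1 < P.size → rootedArea P r b (c + 1) < rootedArea P r b c) {k : ℕ}
    (hck : c ≤ k) (hk : k < P.size) : rootedArea P r b k ≤ rootedArea P r b c := by
  have descent (j : ℕ) (hcj : c ≤ j) :
      j + 1 < P.size → rootedArea P r b (j + 1) < rootedArea P r b j := by
    induction j, hcj using Nat.le_induction with
    | base => exact hlast
    | succ j hcj ih =>
      exact fun hj => rootedArea_succ_lt h h0 (by omega) hj (ih (by omega))
  induction k, hck using Nat.le_induction with
  | base => exact le_rfl
  | succ k hck ih => exact (descent k hck hk).le.trans (ih (by omega))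

theorem climb_spec (h : IsConvexPolygon P) (hbc : b < c) (hc : c < P.size)
    (hA : Ascending P r b c) :
    Ascending P r b (climb P r b c).val ∧
      ((climb P r b c).val + 1 < P.size →
        rootedArea P r b ((climb P r b c).val + 1) < rootedArea P r b (climb P r b c).val) := by
  fun_induction climb P r b c with
  | case1 c hn ih =>
    simp only [Timed.val_bind, Timed.val_ops, decide_eq_true_eq, area_triAt h hbc.le hc.le,
      area_triAt h (show b ≤ c + 1 by omega) hn.le, div_le_div_iff_of_pos_right (zero_lt_two' ℝ)]
    split_ifs with hup
    · refine ih (by omega) hn fun j hbj hjc => ?_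
      rcases Nat.lt_succ_iff_lt_or_eq.1 hjc with hjc | rfl
      · exact hA j hbj hjc
      · exact hup
    · exact ⟨hA, fun _ => not_le.1 hup⟩
  | case2 c hn => exact ⟨hA, fun h => absurd h hn⟩

theorem IsBestBefore.step (hbest : IsBestBefore P r b best) (hb : 0 < b) (hbc : b < c)
    (hc : c < P.size)
    (hmax : ∀ k, b < k → k < P.size → rootedArea P r b k ≤ rootedArea P r b c) :
    IsBestBefore P r (b + 1)
      (if rootedArea P r best.1 best.2 < rootedArea P r b c then (b, c) else best) := by
  obtain ⟨valid, le_best⟩ := hbest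
  split_ifs with hlt
  · refine ⟨⟨hb, hbc, hc⟩, fun i k hi hib hik hk => ?_⟩
    rcases Nat.lt_succ_iff_lt_or_eq.1 hib with hib | rfl
    · exact (le_best i k hi hib hik hk).trans hlt.le
    · exact hmax k hik hk
  · refine ⟨valid, fun i k hi hib hik hk => ?_⟩
    rcases Nat.lt_succ_iff_lt_or_eq.1 hib with hib | rfl
    · exact le_best i k hi hib hik hk
    · exact (hmax k hik hk).trans (not_lt.1 hlt)

theorem sweep_spec (h : IsConvexPolygon P) (hb : 0 < b) (hc : c < P.size)
    (hA : Ascending P r b c) (hbest : IsBestBefore P r b best) :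
    IsBestBefore P r P.size (sweep P r b c best).val := by
  fun_induction sweep P r b c best with
  | case1 b c best hn ih =>
    have hc₀ : max c (b + 1) < P.size := by omega
    obtain ⟨le_climb, climb_lt, -⟩ := climb_bounds (r := r) (b := b) hc₀
    obtain ⟨asc, desc⟩ := climb_spec (r := r) h (show b < max c (b + 1) by omega) hc₀
      fun j hbj hjc => hA j hbj (by omega)
    simp only [Timed.val_bind, Timed.val_ops]
    set c₁ := (climb P r b (max c (b + 1))).val
    refine ih _ _ b.succ_pos climb_lt (fun j hbj hjc =>
      rootedArea_le_succ h hb b.lt_succ_self hbj.le (by omega) (asc j (by omega) hjc)) ?_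
    simp only [decide_eq_true_eq, area_triAt h hbest.1.2.1.le hbest.1.2.2.le,
      area_triAt h (show b ≤ c₁ by omega) climb_lt.le, div_lt_div_iff_of_pos_right (zero_lt_two' ℝ)]
    refine hbest.step hb (by omega) climb_lt fun k hbk hk => ?_
    rcases le_total k c₁ with hkc | hck
    · exact asc.le hbk hkc
    · exact rootedArea_le_of_descent h hb (by omega) desc hck hk
  | case2 b c best hn =>
    exact ⟨hbest.1, fun i k hi _ hik hk => hbest.2 i k hi (by omega) hik hk⟩

theorem rootedOffsets_spec (h : IsConvexPolygon P) (r : ℕ) :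
    IsBestBefore P r P.size (rootedOffsets P r).val := by
  have size_ge := h.1
  exact sweep_spec h one_pos (by omega) (fun j _ _ => by omega)
    ⟨⟨one_pos, one_lt_two, size_ge⟩, fun i k _ _ => by omega⟩

end Sweep

/-! ### Triangles that are largest for a root -/

section Rooted

variable {P : Array Pt}

theorem abs_cw_le_rootedOffsets (h : IsConvexPolygon P) (r : ℕ) {q s : Pt} (hq : q ∈ P)
    (hs : s ∈ P) : |cw (offs P r 0) q s| ≤
      rootedArea P r (rootedOffsets P r).val.1 (rootedOffsets P r).val.2 := by
  obtain ⟨⟨-, valid_lt, valid_size⟩, le_best⟩ := rootedOffsets_spec h r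
  have hV := h.isCyclicConvex_offs r
  have nonneg : 0 ≤ rootedArea P r (rootedOffsets P r).val.1 (rootedOffsets P r).val.2 :=
    hV.nonneg (by omega) (by omega) (by omega)
  have ordered {i j : ℕ} (hij : i < j) (hj : j < P.size) :
      |cw (offs P r 0) (offs P r i) (offs P r j)| ≤
        rootedArea P r (rootedOffsets P r).val.1 (rootedOffsets P r).val.2 := by
    rw [abs_of_nonneg (hV.nonneg (by omega) (by omega) (by omega))]
    rcases Nat.eq_zero_or_pos i with rfl | hi
    · rwa [Nat.cast_zero, cw_self_left]
    · exact le_best i j hi (hij.trans hj) hij hj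
  obtain ⟨i, hi, rfl⟩ := exists_offs_eq hq r
  obtain ⟨j, hj, rfl⟩ := exists_offs_eq hs r
  rcases lt_trichotomy i j with hij | rfl | hji
  · exact ordered hij hj
  · rwa [cw_self_right, abs_zero]
  · rw [cw_swap, abs_neg]
    exact ordered hji hi

theorem isLargestRooted_rootedTriangle (h : IsConvexPolygon P) (r : ℕ) :
    IsLargestRooted P (vtx P r) (rootedTriangle P r).val := by
  obtain ⟨⟨-, valid_lt, valid_size⟩, -⟩ := rootedOffsets_spec h r
  refine ⟨⟨⟨vtx_mem h.size_pos _, vtx_mem h.size_pos _, vtx_mem h.size_pos _⟩, rfl⟩,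
    fun q hq s hs => ?_⟩
  have root_eq : offs P r 0 = vtx P r := offs_natCast P r 0
  simp only [rootedTriangle, Timed.val_bind, Timed.val_ops]
  rw [area_triAt h valid_lt.le valid_size.le, area_eq_abs_cw, ← root_eq]
  exact div_le_div_of_nonneg_right (abs_cw_le_rootedOffsets h r hq hs) zero_le_two

theorem rootedTriangle_time (hP : 3 ≤ P.size) (r : ℕ) :
    (rootedTriangle P r).time ≤ 204 * P.size + 12 :=
  Nat.add_le_add_right (rootedOffsets_time hP r) 12

theorem isMaxThrough_rootedOffsets (h : IsConvexPolygon P) (r : ℕ) :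
    IsMaxThrough (offs P r) 0 0 (rootedOffsets P r).val.1 (rootedOffsets P r).val.2 :=
  fun _ _ => (le_abs_self _).trans
    (abs_cw_le_rootedOffsets h r (offs_mem h.size_pos _ _) (offs_mem h.size_pos _ _))

theorem offs_mod (P : Array Pt) (a m : ℕ) (z : ℤ) :
    offs P ((a + m) % P.size) z = offs P a (m + z) := by
  rw [offs, offs, cyc, cyc, Int.natCast_mod, Int.emod_add_emod, Nat.cast_add, add_assoc]

theorem isMaxRooted_offs (h : IsConvexPolygon P) (a m : ℕ) {o : ℕ × ℕ}
    (ho : o = (rootedOffsets P ((a + m) % P.size)).val) :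
    IsMaxRooted (offs P a) m (m + o.1 : ℕ) (m + o.2 : ℕ) := by
  refine Or.inl fun z w => ?_
  have le_best := isMaxThrough_rootedOffsets h ((a + m) % P.size) (z - m) (w - m)
  simpa only [← ho, offs_mod, add_zero, add_sub_cancel, ← Nat.cast_add] using le_best

theorem insertionSort_offsets {n m b c : ℕ} (hm : m < n) (hbc : b < c) (hc : c < n) :
    (m + c < n ∧
      List.insertionSort (· ≤ ·) [m, (m + b) % n, (m + c) % n] = [m, m + b, m + c]) ∨
    ((m + b < n ∧ n ≤ m + c) ∧
      List.insertionSort (· ≤ ·) [m, (m + b) % n, (m + c) % n] = [m + c - n, m, m + b]) ∨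
    (n ≤ m + b ∧
      List.insertionSort (· ≤ ·) [m, (m + b) % n, (m + c) % n] = [m + b - n, m + c - n, m]) := by
  have mod_of_ge {x : ℕ} (hx : x < n) (hmx : n ≤ m + x) : (m + x) % n = m + x - n := by
    rw [Nat.mod_eq_sub_mod hmx, Nat.mod_eq_of_lt (by omega)]
  rcases lt_or_ge (m + c) n with hmc | hmc
  · refine Or.inl ⟨hmc, ?_⟩
    rw [Nat.mod_eq_of_lt hmc, Nat.mod_eq_of_lt (by omega)]
    exact insertionSort_eq_of_perm (List.Perm.refl _) (by grind)
  rcases lt_or_ge (m + b) n with hmb | hmb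
  · refine Or.inr (Or.inl ⟨⟨hmb, hmc⟩, ?_⟩)
    rw [mod_of_ge hc hmc, Nat.mod_eq_of_lt hmb]
    exact insertionSort_eq_of_perm
      (List.perm_append_comm (l₁ := [m, m + b]) (l₂ := [m + c - n])) (by grind)
  · refine Or.inr (Or.inr ⟨hmb, ?_⟩)
    rw [mod_of_ge hc hmc, mod_of_ge (hbc.trans hc) hmb]
    exact insertionSort_eq_of_perm
      (List.perm_append_comm (l₁ := [m]) (l₂ := [m + b - n, m + c - n])) (by grind)

theorem exists_sorted_rootedOffsets (h : IsConvexPolygon P) (a : ℕ) {m : ℕ} (hm : m < P.size)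
    {o : ℕ × ℕ} (ho : o = (rootedOffsets P ((a + m) % P.size)).val) :
    ∃ m₀ m₁ m₂ : ℕ, (m₀ < m₁ ∧ m₁ < m₂ ∧ m₂ < P.size) ∧ m ∈ [m₀, m₁, m₂] ∧
      List.insertionSort (· ≤ ·) [m, (m + o.1) % P.size, (m + o.2) % P.size] = [m₀, m₁, m₂] ∧
      IsMaxRooted (offs P a) m₀ m₁ m₂ := by
  obtain ⟨valid_pos, valid_lt, valid_size⟩ : ValidOffsets P o :=
    ho ▸ (rootedOffsets_spec h ((a + m) % P.size)).1
  have periodic := (h.isCyclicConvex_offs a).periodic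
  have rooted := isMaxRooted_offs h a m ho
  have rooted' := rooted.rotate' periodic
  have rooted'' := rooted'.rotate' periodic
  rcases insertionSort_offsets hm valid_lt valid_size with
    ⟨hmc, sorted⟩ | ⟨⟨hmb, hmc⟩, sorted⟩ | ⟨hmb, sorted⟩
  · exact ⟨_, _, _, by omega, by simp only [List.mem_cons, true_or], sorted, rooted⟩
  · rw [← Nat.cast_sub hmc] at rooted'
    exact ⟨_, _, _, by omega, by simp only [List.mem_cons, true_or, or_true], sorted, rooted'⟩
  · rw [← Nat.cast_sub hmb, ← Nat.cast_sub (by omega)] at rooted''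
    exact ⟨_, _, _, by omega, by simp only [List.mem_cons, true_or, or_true], sorted, rooted''⟩

end Rooted

/-! ### Triangles that are largest overall -/

section Optimal

variable {P Q : Array Pt} {T S : Tri}

theorem area_rotate (p q r : Pt) : area (q, r, p) = area (p, q, r) := by
  rw [area_eq_abs_cw, area_eq_abs_cw, cw_rotate]

theorem area_swap (p q r : Pt) : area (p, r, q) = area (p, q, r) := by
  rw [area_eq_abs_cw, area_eq_abs_cw, cw_swap, abs_neg]

theorem mem_region {p : Pt} (hp : p ∈ P) : p ∈ region P := subset_convexHull ℝ _ hp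

theorem three_distinct_induction {p : ℕ → ℕ → ℕ → Prop} (rotate : ∀ i j k, p i j k → p j k i)
    (swap : ∀ i j k, p i j k → p i k j) (sorted : ∀ i j k, i < j → j < k → p i j k) {i j k : ℕ}
    (hij : i ≠ j) (hjk : j ≠ k) (hik : i ≠ k) : p i j k := by
  rcases lt_or_gt_of_ne hij with hij | hij <;> rcases lt_or_gt_of_ne hjk with hjk | hjk <;>
    rcases lt_or_gt_of_ne hik with hik | hik
  · exact sorted i j k hij hjk
  · omega
  · exact swap _ _ _ (sorted i k j hik hjk)
  · exact rotate _ _ _ (sorted k i j hik hij)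
  · exact rotate _ _ _ (rotate _ _ _ (swap _ _ _ (sorted j i k hij hik)))
  · exact rotate _ _ _ (rotate _ _ _ (sorted j k i hjk hik))
  · omega
  · exact rotate _ _ _ (swap _ _ _ (sorted k j i hjk hij))

theorem exists_sorted_offsets (hT : Aligned P T) (hne : area T ≠ 0) (a : ℕ) :
    ∃ i j k : ℕ, (i < j ∧ j < k ∧ k < P.size) ∧
      area (offs P a i, offs P a j, offs P a k) = area T ∧
      ∀ Q, Aligned Q (offs P a i, offs P a j, offs P a k) → Aligned Q T := by
  obtain ⟨p, q, r⟩ := T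
  obtain ⟨hp, hq, hr⟩ := hT
  obtain ⟨i, hi, rfl⟩ := exists_offs_eq hp a
  obtain ⟨j, hj, rfl⟩ := exists_offs_eq hq a
  obtain ⟨k, hk, rfl⟩ := exists_offs_eq hr a
  rw [area_eq_abs_cw] at hne
  have hij : i ≠ j := by
    rintro rfl
    simp [cw_self_left] at hne
  have hjk : j ≠ k := by
    rintro rfl
    simp [cw_self_right] at hne
  have hik : i ≠ k := by
    rintro rfl
    simp [cw_self_outer] at hne
  clear hne hp hq hr
  revert hi hj hk
  refine three_distinct_induction (p := fun i j k => i < P.size → j < P.size → k < P.size →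
    ∃ t₀ t₁ t₂ : ℕ, (t₀ < t₁ ∧ t₁ < t₂ ∧ t₂ < P.size) ∧
      area (offs P a t₀, offs P a t₁, offs P a t₂) = area (offs P a i, offs P a j, offs P a k) ∧
      ∀ Q, Aligned Q (offs P a t₀, offs P a t₁, offs P a t₂) →
        Aligned Q (offs P a i, offs P a j, offs P a k)) ?_ ?_ ?_ hij hjk hik
  · intro i j k ih hj hk hi
    obtain ⟨t₀, t₁, t₂, ht, area_eq, aligned⟩ := ih hi hj hk
    exact ⟨t₀, t₁, t₂, ht, area_eq.trans (area_rotate _ _ _).symm, fun Q hQ =>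
      and_rotate.1 (aligned Q hQ)⟩
  · intro i j k ih hi hk hj
    obtain ⟨t₀, t₁, t₂, ht, area_eq, aligned⟩ := ih hi hj hk
    exact ⟨t₀, t₁, t₂, ht, area_eq.trans (area_swap _ _ _).symm, fun Q hQ =>
      (aligned Q hQ).imp_right And.symm⟩
  · exact fun i j k hij hjk _ _ hk => ⟨i, j, k, ⟨hij, hjk, hk⟩, rfl, fun Q hQ => hQ⟩

theorem IsLargest.area_pos (h : IsConvexPolygon P) (hT : IsLargest P T) : 0 < area T := by
  have hV := h.isCyclicConvex_offs 0
  have size_ge := h.1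
  have hpos := h.size_pos
  have cw_pos := hV.pos (i := 0) (j := 1) (k := 2) (by omega) (by omega) (by omega)
  refine lt_of_lt_of_le ?_ (hT.2 _ (mem_region (offs_mem hpos 0 0)) _
    (mem_region (offs_mem hpos 0 1)) _ (mem_region (offs_mem hpos 0 2)))
  rw [area_eq_abs_cw, abs_of_pos cw_pos]
  exact half_pos cw_pos

theorem exists_isMaxAll_of_isLargest (h : IsConvexPolygon P) (a : ℕ) (hT : IsLargest P T) :
    ∃ t₀ t₁ t₂ : ℕ, (t₀ < t₁ ∧ t₁ < t₂ ∧ t₂ < P.size) ∧ IsMaxAll (offs P a) t₀ t₁ t₂ ∧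
      ∀ Q, Aligned Q (offs P a t₀, offs P a t₁, offs P a t₂) → Aligned Q T := by
  obtain ⟨i, j, k, ⟨hij, hjk, hk⟩, area_eq, aligned⟩ :=
    exists_sorted_offsets hT.1 (hT.area_pos h).ne' a
  refine ⟨i, j, k, ⟨hij, hjk, hk⟩, fun x y z => ?_, aligned⟩
  have area_le := hT.2 _ (mem_region (offs_mem h.size_pos a x)) _
    (mem_region (offs_mem h.size_pos a y)) _ (mem_region (offs_mem h.size_pos a z))
  have cw_pos : 0 < cw (offs P a i) (offs P a j) (offs P a k) :=
    (h.isCyclicConvex_offs a).pos (by omega) (by omega) (by omega)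
  rw [← area_eq, area_eq_abs_cw, area_eq_abs_cw, abs_of_pos cw_pos,
    div_le_div_iff_of_pos_right (zero_lt_two' ℝ)] at area_le
  exact (le_abs_self _).trans area_le

theorem convexOn_area (q r : Pt) : ConvexOn ℝ Set.univ (fun p => area (p, q, r)) := by
  refine ⟨convex_univ, fun x _ y _ s t hs ht hst => ?_⟩
  have cw_combo : cw (s • x + t • y) q r = s * cw x q r + t * cw y q r := by
    obtain rfl : t = 1 - s := by linarith
    simp only [cw, cross, Prod.fst_add, Prod.snd_add, Prod.smul_fst, Prod.smul_snd, smul_eq_mul]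
    ring
  have triangle := abs_add_le (s * cw x q r) (t * cw y q r)
  rw [abs_mul, abs_mul, abs_of_nonneg hs, abs_of_nonneg ht] at triangle
  simp only [area_eq_abs_cw, smul_eq_mul, cw_combo]
  linarith

theorem exists_mem_area_le {p : Pt} (hp : p ∈ region P) (q r : Pt) :
    ∃ p' ∈ P, area (p, q, r) ≤ area (p', q, r) :=
  (convexOn_area q r).exists_ge_of_mem_convexHull (Set.subset_univ _) hp

theorem isLargest_of_forall_mem (hT : Aligned P T)
    (hmax : ∀ p ∈ P, ∀ q ∈ P, ∀ r ∈ P, area (p, q, r) ≤ area T) : IsLargest P T := by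
  refine ⟨hT, fun p hp q hq r hr => ?_⟩
  obtain ⟨p', hp', le_p'⟩ := exists_mem_area_le hp q r
  obtain ⟨q', hq', le_q'⟩ := exists_mem_area_le hq r p'
  obtain ⟨r', hr', le_r'⟩ := exists_mem_area_le hr p' q'
  calc area (p, q, r)
      ≤ area (p', q, r) := le_p'
    _ = area (q, r, p') := (area_rotate _ _ _).symm
    _ ≤ area (q', r, p') := le_q'
    _ = area (r, p', q') := (area_rotate _ _ _).symm
    _ ≤ area (r', p', q') := le_r'
    _ ≤ area T := hmax r' hr' p' hp' q' hq'

theorem IsLargest.of_aligned (hQ : ∀ p ∈ Q, p ∈ P) (hT : IsLargest P T) (hTQ : Aligned Q T)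
    (hS : IsLargest Q S) : IsLargest P S :=
  ⟨⟨hQ _ hS.1.1, hQ _ hS.1.2.1, hQ _ hS.1.2.2⟩, fun p hp q hq r hr =>
    (hT.2 p hp q hq r hr).trans
      (hS.2 _ (mem_region hTQ.1) _ (mem_region hTQ.2.1) _ (mem_region hTQ.2.2))⟩

theorem IsLargest.of_area_le (hT : IsLargest P T) (hS : Aligned P S) (hTS : area T ≤ area S) :
    IsLargest P S :=
  ⟨hS, fun p hp q hq r hr => (hT.2 p hp q hq r hr).trans hTS⟩

end Optimal

section BestOverRoots

variable {P : Array Pt}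

theorem larger_val (T S : Tri) : (larger T S).val = if area T ≤ area S then S else T := by
  simp only [larger, Timed.val_bind, Timed.val_ops, decide_eq_true_eq]
  split_ifs <;> rfl

theorem area_larger (T S : Tri) : area (larger T S).val = max (area T) (area S) := by
  rw [larger_val, apply_ite area, max_def]

theorem Aligned.larger {T S : Tri} (hT : Aligned P T) (hS : Aligned P S) :
    Aligned P (larger T S).val := by
  rw [larger_val]
  split_ifs
  exacts [hS, hT]

theorem larger_time (T S : Tri) : (larger T S).time = 50 := by
  simp only [larger, Timed.time_bind, Timed.time_ops]
  split_ifs <;> rfl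

theorem bestOverRoots_spec (h : IsConvexPolygon P) (k : ℕ) :
    Aligned P (bestOverRoots P k).val ∧ ∀ i ≤ k, ∀ q ∈ P, ∀ r ∈ P,
      area (vtx P i, q, r) ≤ area (bestOverRoots P k).val := by
  induction k with
  | zero =>
    obtain ⟨⟨aligned, -⟩, le_area⟩ := isLargestRooted_rootedTriangle h 0
    refine ⟨aligned, fun i hi => ?_⟩
    obtain rfl := Nat.le_zero.1 hi
    exact le_area
  | succ k ih =>
    obtain ⟨⟨aligned, -⟩, le_area⟩ := isLargestRooted_rootedTriangle h (k + 1)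
    simp only [bestOverRoots, Timed.val_bind, area_larger]
    refine ⟨ih.1.larger aligned, fun i hi q hq r hr => ?_⟩
    rcases Nat.le_succ_iff.1 hi with hi | rfl
    · exact le_max_of_le_left (ih.2 i hi q hq r hr)
    · exact le_max_of_le_right (le_area q hq r hr)

theorem isLargest_bestOverRoots (h : IsConvexPolygon P) :
    IsLargest P (bestOverRoots P (P.size - 1)).val := by
  obtain ⟨aligned, le_area⟩ := bestOverRoots_spec h (P.size - 1)
  refine isLargest_of_forall_mem aligned fun p hp => ?_
  obtain ⟨i, hi, rfl⟩ := exists_vtx_eq hp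
  exact le_area i (by omega)

theorem bestOverRoots_time (hP : 3 ≤ P.size) (k : ℕ) :
    (bestOverRoots P k).time ≤ (k + 1) * (204 * P.size + 62) := by
  induction k with
  | zero => exact (rootedTriangle_time hP 0).trans (by omega)
  | succ k ih =>
    simp only [bestOverRoots, Timed.time_bind, larger_time]
    have root_time := rootedTriangle_time hP (k + 1)
    linarith

end BestOverRoots

/-! ### Selecting vertices -/

section Select

open Classical in
/-- The offsets `i < k` satisfying `keep`, in increasing order. -/
noncomputable def keptOffsets (keep : ℕ → Prop) (k : ℕ) : List ℕ := (List.range k).filter keep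

variable {P : Array Pt} {a k : ℕ} {keep : ℕ → Prop} {X : ℕ → ℕ}

theorem select_time (P : Array Pt) (a : ℕ) (keep : ℕ → Prop) (k : ℕ) :
    (select P a keep k).time ≤ 46 * k + 1 := by
  induction k with
  | zero => exact le_rfl
  | succ k ih =>
    simp only [select, Timed.time_bind, Timed.time_ops]
    split_ifs
    · rw [Timed.time_ops]
      omega
    · rw [Timed.time_pure]
      omega

theorem toList_select (P : Array Pt) (a : ℕ) (keep : ℕ → Prop) (k : ℕ) :
    (select P a keep k).val.toList = (keptOffsets keep k).map fun i => vtx P (a + i) := by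
  induction k with
  | zero => rfl
  | succ k ih =>
    simp only [select, Timed.val_bind, Timed.val_ops, decide_eq_true_eq, keptOffsets,
      List.range_succ, List.filter_append, List.map_append, List.filter_singleton] at ih ⊢
    split_ifs <;> simp [*]

theorem mem_keptOffsets {i : ℕ} : i ∈ keptOffsets keep k ↔ i < k ∧ keep i := by
  simp [keptOffsets]

theorem size_select (P : Array Pt) (a : ℕ) (keep : ℕ → Prop) (k : ℕ) :
    (select P a keep k).val.size = (keptOffsets keep k).length := by
  rw [← Array.length_toList, toList_select, List.length_map]

theorem mem_select_iff {p : Pt} :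
    p ∈ (select P a keep k).val ↔ ∃ i < k, keep i ∧ vtx P (a + i) = p := by
  simp only [← Array.mem_toList_iff, toList_select, List.mem_map, mem_keptOffsets, and_assoc]

theorem offs_mem_select {i : ℕ} (hi : i < k) (h : keep i) :
    offs P a i ∈ (select P a keep k).val :=
  mem_select_iff.2 ⟨i, hi, h, (offs_natCast P a i).symm⟩

theorem mem_of_mem_select (hP : 0 < P.size) {p : Pt} (hp : p ∈ (select P a keep k).val) :
    p ∈ P := by
  obtain ⟨i, -, -, rfl⟩ := mem_select_iff.1 hp
  exact vtx_mem hP _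

theorem vtx_select {i : ℕ} (hi : i < (keptOffsets keep k).length) :
    vtx (select P a keep k).val i = offs P a ((keptOffsets keep k)[i] : ℕ) := by
  have hi' : i < (select P a keep k).val.size := by rwa [size_select]
  rw [vtx, Nat.mod_eq_of_lt hi', Array.getD_eq_getD_getElem?, ← Array.getElem?_toList,
    toList_select, List.getElem?_map, List.getElem?_eq_getElem hi, offs_natCast]
  rfl

theorem isConvexPolygon_select (h : IsConvexPolygon P)
    (size_ge : 3 ≤ (select P a keep P.size).val.size) :
    IsConvexPolygon (select P a keep P.size).val := by
  refine ⟨size_ge, fun i j k hij hjk hk => ?_⟩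
  rw [size_select] at hk
  have increasing : (keptOffsets keep P.size).Pairwise (· < ·) :=
    List.pairwise_lt_range.filter _
  rw [List.pairwise_iff_getElem] at increasing
  have lt_ij := increasing i j (by omega) (by omega) hij
  have lt_jk := increasing j k (by omega) hk hjk
  have lt_size := (mem_keptOffsets.1 (List.getElem_mem hk)).1
  rw [vtx_select (by omega), vtx_select (by omega), vtx_select hk, ← neg_pos]
  exact (h.isCyclicConvex_offs a).pos (by omega) (by omega) (by omega)

open Classical in
theorem size_select_eq_card (P : Array Pt) (a : ℕ) (keep : ℕ → Prop) (k : ℕ) :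
    (select P a keep k).val.size = ((Finset.range k).filter keep).card := by
  rw [size_select]
  rfl

theorem card_le_size_select {s : Finset ℕ} (hs : ∀ i ∈ s, i < k ∧ keep i) :
    s.card ≤ (select P a keep k).val.size := by
  classical
  rw [size_select_eq_card]
  exact Finset.card_le_card fun i hi => by simpa using hs i hi

theorem size_select_add_card_le {s : Finset ℕ} (hs : ∀ i ∈ s, i < k ∧ ¬ keep i) :
    (select P a keep k).val.size + s.card ≤ k := by
  classical
  rw [size_select_eq_card]
  refine (Finset.card_union_of_disjoint (Finset.disjoint_left.2 fun i hi his =>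
    (hs i his).2 (Finset.mem_filter.1 hi).2)).symm.trans_le ?_
  refine (Finset.card_le_card (Finset.union_subset (Finset.filter_subset keep _)
    fun i hi => Finset.mem_range.2 (hs i hi).1)).trans_eq (Finset.card_range k)

theorem size_select_of_avoidsGap {m g : ℕ} (hk : AvoidsGap m g keep) (h0 : Far m g 0)
    (hn : Far m g k) (hm : m < k) : (select P a keep k).val.size + g ≤ k + 1 := by
  unfold Far at h0 hn
  rcases hk with hk | hk
  · have size_le := size_select_add_card_le (P := P) (a := a) (k := k) (keep := keep)
      (s := Finset.Ioo (m - g) m) fun i hi => ⟨by grind, hk i (by grind) (by grind)⟩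
    rw [Nat.card_Ioo] at size_le
    omega
  · have size_le := size_select_add_card_le (P := P) (a := a) (k := k) (keep := keep)
      (s := Finset.Ioo m (m + g)) fun i hi => ⟨by grind, hk i (by grind) (by grind)⟩
    rw [Nat.card_Ioo] at size_le
    omega

theorem three_le_size_select {x y z : ℕ} (hxyz : x < y ∧ y < z ∧ z < k) (hx : keep x)
    (hy : keep y) (hz : keep z) : 3 ≤ (select P a keep k).val.size := by
  have card_eq : ({x, y, z} : Finset ℕ).card = 3 :=
    Finset.card_eq_three.2 ⟨x, y, z, by omega, by omega, by omega, rfl⟩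
  rw [← card_eq]
  exact card_le_size_select (by grind)

theorem size_select_add (P : Array Pt) (a k : ℕ)
    (hX : X 0 ≤ X 1 ∧ X 1 ≤ X 2 ∧ X 2 ≤ X 3 ∧ X 3 ≤ X 4 ∧ X 4 ≤ X 5) :
    (select P a (KeepFirst X) k).val.size + (select P a (KeepSecond X) k).val.size ≤
      k + 6 := by
  classical
  rw [size_select_eq_card, size_select_eq_card, ← Finset.card_union_add_card_inter]
  refine add_le_add ?_ ?_
  · exact (Finset.card_le_card (Finset.union_subset (Finset.filter_subset _ _)
      (Finset.filter_subset _ _))).trans_eq (Finset.card_range k)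
  · have shared_subset : (Finset.range k).filter (KeepFirst X) ∩
        (Finset.range k).filter (KeepSecond X) ⊆ {X 0, X 1, X 2, X 3, X 4, X 5} := by
      intro i hi
      simp only [Finset.mem_inter, Finset.mem_filter, KeepFirst, KeepSecond] at hi
      simp only [Finset.mem_insert, Finset.mem_singleton]
      omega
    exact (Finset.card_le_card shared_subset).trans Finset.card_le_six

end Select

/-! ### Dividing a polygon -/

section Divide

/-- The offsets of the vertices of the first dividing triangle. -/
noncomputable def firstTriple (P : Array Pt) (a : ℕ) : List ℕ :=
  [0, (rootedOffsets P a).val.1, (rootedOffsets P a).val.2]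

/-- First vertex and length of a longest boundary interval cut out by the first dividing
triangle. -/
noncomputable def longestArc (P : Array Pt) (a : ℕ) : ℕ × ℕ :=
  longestInterval P.size (rootedOffsets P a).val.1 (rootedOffsets P a).val.2

/-- The offset of the root of the second dividing triangle, the median vertex of the longest
interval. -/
noncomputable def medianOffset (P : Array Pt) (a : ℕ) : ℕ :=
  (longestArc P a).1 + (longestArc P a).2 / 2

/-- The other two vertices of the second dividing triangle, as offsets from its own root. -/
noncomputable def medianOffsets (P : Array Pt) (a : ℕ) : ℕ × ℕ :=
  (rootedOffsets P ((a + medianOffset P a) % P.size)).val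

/-- The offsets of the vertices of the second dividing triangle, in increasing order. -/
noncomputable def secondTriple (P : Array Pt) (a : ℕ) : List ℕ :=
  List.insertionSort (· ≤ ·) [medianOffset P a,
    (medianOffset P a + (medianOffsets P a).1) % P.size,
    (medianOffset P a + (medianOffsets P a).2) % P.size]

/-- The offsets `x₀ ≤ ⋯ ≤ x₅` of the vertices of both dividing triangles. -/
noncomputable def cutOffset (P : Array Pt) (a : ℕ) : ℕ → ℕ :=
  mergedOffset (firstTriple P a) (secondTriple P a)

/-- The polygon `P'`, which has the vertices in `[x₀, x₁] ∪ [x₂, x₃] ∪ [x₄, x₅]`. -/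
noncomputable def firstPart (P : Array Pt) (a : ℕ) : Array Pt :=
  (select P a (KeepFirst (cutOffset P a)) P.size).val

/-- The polygon `P''`, which has the vertices in `[x₁, x₂] ∪ [x₃, x₄] ∪ [x₅, x₀]`. -/
noncomputable def secondPart (P : Array Pt) (a : ℕ) : Array Pt :=
  (select P a (KeepSecond (cutOffset P a)) P.size).val

/-- The last step of the division: the choice of the subproblems. The proposition `I` says that the
dividing triangles interleave, and `F` that only the first candidate can contain a triangle that
interleaves with both. -/
def chooseParts (I F : Prop) [Decidable I] [Decidable F] (Q R : Array Pt) : Timed Split := do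
  let both ← ops 100 (decide I)
  if both then pure (.two Q R)
  else
    let first ← ops 100 (decide F)
    if first then pure (.one Q) else pure (.one R)

/-- The increasing offsets `0, a₁, a₂` and `m₀, m₁, m₂` of the dividing triangles, and a vertex `m`
of the second one that is at distance at least `g` from the first one. -/
structure IsDivision (P : Array Pt) (a a₁ a₂ m₀ m₁ m₂ m g : ℕ) : Prop where
  first_eq : firstTriple P a = [0, a₁, a₂]
  second_eq : secondTriple P a = [m₀, m₁, m₂]
  first_lt : 0 < a₁ ∧ a₁ < a₂ ∧ a₂ < P.size
  second_lt : m₀ < m₁ ∧ m₁ < m₂ ∧ m₂ < P.size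
  isMaxRooted_first : IsMaxRooted (offs P a) (0 : ℕ) a₁ a₂
  isMaxRooted_second : IsMaxRooted (offs P a) m₀ m₁ m₂
  mem_second : m ∈ [m₀, m₁, m₂]
  far : ∀ x ∈ [0, a₁, a₂], Far m g x
  far_size : Far m g P.size
  size_le : P.size ≤ 6 * g + 3

variable {P Q R : Array Pt} {a a₁ a₂ m₀ m₁ m₂ m g : ℕ}

theorem chooseParts_val (I F : Prop) [Decidable I] [Decidable F] (Q R : Array Pt) :
    (chooseParts I F Q R).val = if I then .two Q R else if F then .one Q else .one R := by
  by_cases hI : I <;> by_cases hF : F <;> simp [chooseParts, hI, hF]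

theorem chooseParts_time (I F : Prop) [Decidable I] [Decidable F] (Q R : Array Pt) :
    (chooseParts I F Q R).time ≤ 200 := by
  by_cases hI : I <;> by_cases hF : F <;> simp [chooseParts, hI, hF]

open Classical in
/-- Chosen to agree definitionally with the instance by which `divide` decides this. -/
noncomputable instance (u v : List ℕ) (X : ℕ → ℕ) : Decidable (FirstMixed u v X) :=
  inferInstanceAs (Decidable (_ ∧ _ ∧ _))

open Classical in
theorem divide_val (P : Array Pt) (a : ℕ) : (divide P a).val =
    if Interleave (firstTriple P a) (secondTriple P a) then .two (firstPart P a) (secondPart P a)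
    else if FirstMixed (firstTriple P a) (secondTriple P a) (cutOffset P a) then
      .one (firstPart P a)
    else .one (secondPart P a) :=
  chooseParts_val _ _ _ _

open Classical in
theorem divide_time_eq (P : Array Pt) (a : ℕ) : (divide P a).time =
    (rootedOffsets P a).time + (12 + (2 + (2 +
      ((rootedOffsets P ((a + medianOffset P a) % P.size)).time + (3 + (30 + (60 +
      ((select P a (KeepFirst (cutOffset P a)) P.size).time +
      ((select P a (KeepSecond (cutOffset P a)) P.size).time +
      (chooseParts (Interleave (firstTriple P a) (secondTriple P a))
        (FirstMixed (firstTriple P a) (secondTriple P a) (cutOffset P a))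
        (firstPart P a) (secondPart P a)).time))))))))) :=
  rfl

theorem divide_time (hP : 3 ≤ P.size) (a : ℕ) : (divide P a).time ≤ 680 * P.size := by
  classical
  have first_sweep := rootedOffsets_time hP a
  have second_sweep := rootedOffsets_time hP ((a + medianOffset P a) % P.size)
  have first_select := select_time P a (KeepFirst (cutOffset P a)) P.size
  have second_select := select_time P a (KeepSecond (cutOffset P a)) P.size
  have choose_parts := chooseParts_time (Interleave (firstTriple P a) (secondTriple P a))
    (FirstMixed (firstTriple P a) (secondTriple P a) (cutOffset P a))
    (firstPart P a) (secondPart P a)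
  rw [divide_time_eq]
  omega

theorem mem_parts_divide : Q ∈ (divide P a).val.parts ↔
    (Interleave (firstTriple P a) (secondTriple P a) ∨
        FirstMixed (firstTriple P a) (secondTriple P a) (cutOffset P a)) ∧ Q = firstPart P a ∨
      (Interleave (firstTriple P a) (secondTriple P a) ∨
        ¬ FirstMixed (firstTriple P a) (secondTriple P a) (cutOffset P a)) ∧
        Q = secondPart P a := by
  rw [divide_val]
  split_ifs <;> simp [Split.parts, *]

theorem eq_parts_of_divide_eq_two (hD : (divide P a).val = .two Q R) :
    Q = firstPart P a ∧ R = secondPart P a := by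
  rw [divide_val] at hD
  split_ifs at hD
  cases hD
  exact ⟨rfl, rfl⟩

theorem median_far {n b c : ℕ} (hb : 0 < b) (hbc : b < c) (hc : c < n) (hn : 4 ≤ n)
    (hg : g = (longestInterval n b c).2 / 2) (hm : m = (longestInterval n b c).1 + g) :
    n ≤ 6 * g + 3 ∧ m < n ∧ (Far m g 0 ∧ Far m g b ∧ Far m g c) ∧ Far m g n := by
  simp only [Far]
  rw [longestInterval] at hg hm
  split_ifs at hg hm <;> simp only at hg hm <;> omega

theorem exists_isDivision (h : IsConvexPolygon P) (hn : 4 ≤ P.size) (a : ℕ) :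
    ∃ a₁ a₂ m₀ m₁ m₂ m g, IsDivision P a a₁ a₂ m₀ m₁ m₂ m g := by
  obtain ⟨⟨pos, lt, lt_size⟩, -⟩ := rootedOffsets_spec h a
  obtain ⟨size_le, m_lt, far, far_size⟩ := median_far pos lt lt_size hn rfl rfl
  obtain ⟨m₀, m₁, m₂, second_lt, mem_second, sort_eq, isMax⟩ :=
    exists_sorted_rootedOffsets h a m_lt rfl
  exact ⟨_, _, m₀, m₁, m₂, _, _, rfl, sort_eq, ⟨pos, lt, lt_size⟩, second_lt,
    Or.inl (isMaxThrough_rootedOffsets h a), isMax, mem_second, by simpa using far, far_size,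
    size_le⟩

theorem IsDivision.isMerge_and_exists_aligned (hD : IsDivision P a a₁ a₂ m₀ m₁ m₂ m g)
    (h : IsConvexPolygon P) {T : Tri} (hT : IsLargest P T) :
    IsMerge 0 a₁ a₂ m₀ m₁ m₂ (cutOffset P a) ∧ ∃ Q ∈ (divide P a).val.parts, Aligned Q T := by
  obtain ⟨a_pos, a_lt, a_lt_size⟩ := hD.first_lt
  obtain ⟨m_lt, m_lt', m_lt_size⟩ := hD.second_lt
  obtain ⟨t₀, t₁, t₂, ⟨t_lt, t_lt', t_lt_size⟩, isMaxAll, aligned⟩ :=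
    exists_isMaxAll_of_isLargest h a hT
  have cyclic := h.isCyclicConvex_offs a
  have interleave_first :=
    cyclic.interleave hD.isMaxRooted_first isMaxAll a_pos a_lt (mod_cast a_lt_size) t_lt t_lt'
      (mod_cast t_lt_size)
  have interleave_second :=
    cyclic.interleave hD.isMaxRooted_second isMaxAll m_lt m_lt' (mod_cast m_lt_size) t_lt t_lt'
      (mod_cast t_lt_size)
  have cut_eq : cutOffset P a = mergedOffset [0, a₁, a₂] [m₀, m₁, m₂] := by
    rw [cutOffset, hD.first_eq, hD.second_eq]
  obtain ⟨isMerge, keep⟩ := isMerge_and_keep_of_interleave a_pos a_lt m_lt m_lt' t_lt t_lt'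
    interleave_first interleave_second cut_eq
  rw [← hD.first_eq, ← hD.second_eq] at keep
  refine ⟨isMerge, ?_⟩
  rcases keep with ⟨hIF, k₀, k₁, k₂⟩ | ⟨hIF, k₀, k₁, k₂⟩
  · exact ⟨_, mem_parts_divide.2 (Or.inl ⟨hIF, rfl⟩), aligned _
      ⟨offs_mem_select (by omega) k₀, offs_mem_select (by omega) k₁, offs_mem_select t_lt_size k₂⟩⟩
  · exact ⟨_, mem_parts_divide.2 (Or.inr ⟨hIF, rfl⟩), aligned _
      ⟨offs_mem_select (by omega) k₀, offs_mem_select (by omega) k₁, offs_mem_select t_lt_size k₂⟩⟩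

theorem exists_mem_parts_divide_aligned (h : IsConvexPolygon P) (hn : 4 ≤ P.size) (a : ℕ) {T : Tri}
    (hT : IsLargest P T) : ∃ Q ∈ (divide P a).val.parts, Aligned Q T := by
  obtain ⟨_, _, _, _, _, _, _, hD⟩ := exists_isDivision h hn a
  exact (hD.isMerge_and_exists_aligned h hT).2

theorem IsDivision.isMerge (hD : IsDivision P a a₁ a₂ m₀ m₁ m₂ m g) (h : IsConvexPolygon P) :
    IsMerge 0 a₁ a₂ m₀ m₁ m₂ (cutOffset P a) :=
  (hD.isMerge_and_exists_aligned h (isLargest_bestOverRoots h)).1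

theorem mem_of_mem_parts_divide (hP : 0 < P.size) (hQ : Q ∈ (divide P a).val.parts) {p : Pt}
    (hp : p ∈ Q) : p ∈ P := by
  rcases mem_parts_divide.1 hQ with ⟨-, rfl⟩ | ⟨-, rfl⟩ <;> exact mem_of_mem_select hP hp

theorem isConvexPolygon_of_mem_parts_divide (h : IsConvexPolygon P) (hn : 4 ≤ P.size)
    (hQ : Q ∈ (divide P a).val.parts) : IsConvexPolygon Q := by
  obtain ⟨a₁, a₂, _, _, _, _, _, hD⟩ := exists_isDivision h hn a
  have keep (i) (hi : i ∈ [0, a₁, a₂]) := (hD.isMerge h).keep hi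
  rcases mem_parts_divide.1 hQ with ⟨-, rfl⟩ | ⟨-, rfl⟩
  · exact isConvexPolygon_select h (three_le_size_select hD.first_lt
      (keep 0 (by simp)).1 (keep a₁ (by simp)).1 (keep a₂ (by simp)).1)
  · exact isConvexPolygon_select h (three_le_size_select hD.first_lt
      (keep 0 (by simp)).2 (keep a₁ (by simp)).2 (keep a₂ (by simp)).2)

theorem IsDivision.size_add_le (hD : IsDivision P a a₁ a₂ m₀ m₁ m₂ m g) (h : IsConvexPolygon P)
    (hQ : Q ∈ (divide P a).val.parts) : Q.size + g ≤ P.size + 1 := by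
  obtain ⟨a_pos, a_lt, -⟩ := hD.first_lt
  obtain ⟨m_lt, m_lt', m_lt_size⟩ := hD.second_lt
  have isMerge := hD.isMerge h
  have m_lt_size : m < P.size := by
    have := hD.mem_second
    grind
  rw [mem_parts_divide, hD.first_eq, hD.second_eq] at hQ
  rcases hQ with ⟨hIF, rfl⟩ | ⟨hIF, rfl⟩
  · exact size_select_of_avoidsGap (isMerge.avoidsGap_keepFirst a_pos a_lt m_lt m_lt' hIF
      hD.mem_second hD.far) (hD.far 0 (by simp)) hD.far_size m_lt_size
  · exact size_select_of_avoidsGap (isMerge.avoidsGap_keepSecond a_pos a_lt m_lt m_lt' hIF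
      hD.mem_second hD.far) (hD.far 0 (by simp)) hD.far_size m_lt_size

theorem six_mul_size_le_of_mem_parts_divide (h : IsConvexPolygon P) (hn : 4 ≤ P.size)
    (hQ : Q ∈ (divide P a).val.parts) : 6 * Q.size ≤ 5 * P.size + 9 := by
  obtain ⟨_, _, _, _, _, _, _, hD⟩ := exists_isDivision h hn a
  have size_add_le := hD.size_add_le h hQ
  have size_le := hD.size_le
  omega

theorem size_add_size_le_of_divide_eq_two (h : IsConvexPolygon P) (hn : 4 ≤ P.size)
    (hQR : (divide P a).val = .two Q R) : Q.size + R.size ≤ P.size + 6 := by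
  obtain ⟨_, _, _, _, _, _, _, hD⟩ := exists_isDivision h hn a
  obtain ⟨rfl, rfl⟩ := eq_parts_of_divide_eq_two hQR
  exact size_select_add P a P.size (hD.isMerge h).increasing

end Divide

/-! ### The recursion -/

section Solve

variable {choice : List Bool → ℕ} {d : ℕ} {path : List Bool} {P Q R : Array Pt} {T S U : Tri}

theorem solve_of_size_le_nine (h9 : P.size ≤ 9) :
    solve choice (d + 1) path P =
      ⟨some (bestOverRoots P (P.size - 1)).val, 1 + (bestOverRoots P (P.size - 1)).time⟩ := by
  rw [solve, decide_eq_true h9]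
  rfl

theorem solve_of_divide_eq_one (h9 : 9 < P.size)
    (hD : (divide P (choice path % P.size)).val = .one Q) :
    solve choice (d + 1) path P =
      ⟨(solve choice d (false :: path) Q).val, 1 + (2 + ((divide P (choice path % P.size)).time +
        (solve choice d (false :: path) Q).time))⟩ := by
  rw [solve]
  refine (Timed.mk.injEq _ _ _ _).mpr ⟨?_, ?_⟩ <;> simp [h9.not_ge, hD]

theorem solve_of_divide_eq_two (h9 : 9 < P.size)
    (hD : (divide P (choice path % P.size)).val = .two Q R) :
    solve choice (d + 1) path P =
      ⟨(largerResult (solve choice d (false :: path) Q).val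
          (solve choice d (true :: path) R).val).val,
        1 + (2 + ((divide P (choice path % P.size)).time +
          ((solve choice d (false :: path) Q).time + ((solve choice d (true :: path) R).time +
            (largerResult (solve choice d (false :: path) Q).val
              (solve choice d (true :: path) R).val).time))))⟩ := by
  rw [solve]
  refine (Timed.mk.injEq _ _ _ _).mpr ⟨?_, ?_⟩ <;> simp [h9.not_ge, hD]

theorem Aligned.of_mem_parts_divide (hP : 0 < P.size) {a : ℕ}
    (hQ : Q ∈ (divide P a).val.parts) (hS : Aligned Q S) : Aligned P S :=
  ⟨mem_of_mem_parts_divide hP hQ hS.1, mem_of_mem_parts_divide hP hQ hS.2.1,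
    mem_of_mem_parts_divide hP hQ hS.2.2⟩

theorem IsLargest.larger_of_divide_eq_two (h : IsConvexPolygon P) (hn : 4 ≤ P.size) {a : ℕ}
    (hD : (divide P a).val = .two Q R) (hS : IsLargest Q S) (hU : IsLargest R U) :
    IsLargest P (larger S U).val := by
  have mem_iff (B : Array Pt) : B ∈ (divide P a).val.parts ↔ B = Q ∨ B = R := by
    simp [hD, Split.parts]
  have aligned : Aligned P (larger S U).val :=
    (hS.1.of_mem_parts_divide h.size_pos ((mem_iff Q).2 (Or.inl rfl))).larger
      (hU.1.of_mem_parts_divide h.size_pos ((mem_iff R).2 (Or.inr rfl)))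
  have hT := isLargest_bestOverRoots h
  obtain ⟨B, hB, hTB⟩ := exists_mem_parts_divide_aligned h hn a hT
  have mem_of_mem (p) (hp : p ∈ B) : p ∈ P := mem_of_mem_parts_divide h.size_pos hB hp
  have area_eq : area (larger S U).val = max (area S) (area U) := area_larger S U
  rcases (mem_iff B).1 hB with rfl | rfl
  · exact (hT.of_aligned mem_of_mem hTB hS).of_area_le aligned (area_eq ▸ le_max_left _ _)
  · exact (hT.of_aligned mem_of_mem hTB hU).of_area_le aligned (area_eq ▸ le_max_right _ _)

theorem IsLargest.of_divide_eq_one (h : IsConvexPolygon P) (hn : 4 ≤ P.size) {a : ℕ}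
    (hD : (divide P a).val = .one Q) (hS : IsLargest Q S) : IsLargest P S := by
  have hT := isLargest_bestOverRoots h
  obtain ⟨B, hB, hTB⟩ := exists_mem_parts_divide_aligned h hn a hT
  obtain rfl : B = Q := by simpa [hD, Split.parts] using hB
  exact hT.of_aligned (fun p => mem_of_mem_parts_divide h.size_pos hB) hTB hS

theorem solve_val (h : IsConvexPolygon P) (hd : P.size ≤ d) :
    ∃ T, (solve choice d path P).val = some T ∧ IsLargest P T := by
  induction d generalizing P path with
  | zero => exact absurd h.1 (by omega)
  | succ d ih =>
    rcases le_or_gt P.size 9 with h9 | h9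
    · rw [solve_of_size_le_nine h9]
      exact ⟨_, rfl, isLargest_bestOverRoots h⟩
    have solve_part (B) (hB : B ∈ (divide P (choice path % P.size)).val.parts) (path) :
        ∃ S, (solve choice d path B).val = some S ∧ IsLargest B S := by
      have size_le := six_mul_size_le_of_mem_parts_divide h (by omega) hB
      exact ih (isConvexPolygon_of_mem_parts_divide h (by omega) hB) (by omega)
    rcases hD : (divide P (choice path % P.size)).val with Q | ⟨Q, R⟩ <;>
      rw [hD] at solve_part
    · obtain ⟨S, hS, hS_largest⟩ := solve_part Q (by simp [Split.parts]) (false :: path)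
      rw [solve_of_divide_eq_one h9 hD, hS]
      exact ⟨S, rfl, .of_divide_eq_one h (by omega) hD hS_largest⟩
    · obtain ⟨S, hS, hS_largest⟩ := solve_part Q (by simp [Split.parts]) (false :: path)
      obtain ⟨U, hU, hU_largest⟩ := solve_part R (by simp [Split.parts]) (true :: path)
      rw [solve_of_divide_eq_two h9 hD, hS, hU]
      exact ⟨_, rfl, .larger_of_divide_eq_two h (by omega) hD hS_largest hU_largest⟩

end Solve

/-! ### The running time -/

section Time

variable {choice : List Bool → ℕ} {d : ℕ} {path : List Bool} {P Q R : Array Pt} {n q r w : ℕ}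

/-- The number of vertices apart from the at most six that two subproblems share, so that dividing
a polygon does not increase the total weight. -/
def weight (n : ℕ) : ℕ := max (n - 6) 1

/-- The bound on the running time for a polygon with `n` vertices. Dividing lowers the logarithm by
at least `1 / 60`, and the constant is such that this pays for the `700 * n` operations that
dividing takes. -/
noncomputable def timeBound (n : ℕ) : ℝ := 120000 * weight n * Real.log n

theorem weight_le_weight (hqn : q ≤ n) : weight q ≤ weight n :=
  max_le_max_right 1 (Nat.sub_le_sub_right hqn 6)

theorem weight_add_weight_le (hn : 10 ≤ n) (hqn : q < n) (hrn : r < n) (hqr : q + r ≤ n + 6) :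
    weight q + weight r ≤ weight n := by
  unfold weight
  omega

theorem one_le_log (hn : 3 ≤ n) : 1 ≤ Real.log n := by
  rw [Real.le_log_iff_exp_le (by positivity)]
  exact Real.exp_one_lt_three.le.trans (mod_cast hn)

theorem log_le_log_sub (hq : 0 < q) (hqn : 60 * q ≤ 59 * n) :
    Real.log q ≤ Real.log n - 1 / 60 := by
  have n_pos : 0 < n := by omega
  have q_le : (q : ℝ) ≤ 59 / 60 * n := by
    have : (60 * q : ℝ) ≤ 59 * n := mod_cast hqn
    linarith
  have log_ratio := Real.log_le_sub_one_of_pos (show (0 : ℝ) < 59 / 60 by norm_num)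
  have log_le := Real.log_le_log (by positivity) q_le
  rw [Real.log_mul (by norm_num) (by positivity)] at log_le
  linarith

theorem timeBound_le_of_six_mul_le (hn : 10 ≤ n) (hq : 0 < q) (hqn : 6 * q ≤ 5 * n + 9) :
    timeBound q ≤ 120000 * weight q * (Real.log n - 1 / 60) :=
  mul_le_mul_of_nonneg_left (log_le_log_sub hq (by omega)) (by positivity)

theorem add_le_timeBound (hn : 10 ≤ n) (hw : w ≤ weight n) :
    120000 * w * (Real.log n - 1 / 60) + 700 * n ≤ timeBound n := by
  have weight_eq : (weight n : ℝ) = n - 6 := by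
    rw [weight, max_eq_left (by omega), Nat.cast_sub (by omega), Nat.cast_ofNat]
  have n_ge : (10 : ℝ) ≤ n := mod_cast hn
  have log_ge := one_le_log (show 3 ≤ n by omega)
  calc 120000 * w * (Real.log n - 1 / 60) + 700 * n
    _ ≤ 120000 * weight n * (Real.log n - 1 / 60) + 700 * n := by
        gcongr
        linarith
    _ ≤ timeBound n := by
        rw [timeBound, weight_eq]
        linarith

theorem timeBound_add_le (hn : 10 ≤ n) (hq : 0 < q) (hqn : 6 * q ≤ 5 * n + 9) :
    timeBound q + 700 * n ≤ timeBound n :=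
  (add_le_add_left (timeBound_le_of_six_mul_le hn hq hqn) _).trans
    (add_le_timeBound hn (weight_le_weight (by omega)))

theorem timeBound_add_timeBound_add_le (hn : 10 ≤ n) (hq : 0 < q) (hr : 0 < r)
    (hqn : 6 * q ≤ 5 * n + 9) (hrn : 6 * r ≤ 5 * n + 9) (hqr : q + r ≤ n + 6) :
    timeBound q + timeBound r + 700 * n ≤ timeBound n := by
  have q_bound := timeBound_le_of_six_mul_le hn hq hqn
  have r_bound := timeBound_le_of_six_mul_le hn hr hrn
  have total := add_le_timeBound hn (weight_add_weight_le hn (by omega) (by omega) hqr)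
  rw [Nat.cast_add] at total
  linarith

theorem le_timeBound (hn : 3 ≤ n) : 120000 ≤ timeBound n := by
  have weight_ge : (1 : ℝ) ≤ weight n := mod_cast le_max_right _ _
  rw [timeBound]
  nlinarith [one_le_log hn]

theorem timeBound_le (hn : 3 ≤ n) : timeBound n ≤ 120000 * n * Real.log n := by
  have weight_le : weight n ≤ n := max_le (n.sub_le 6) (by omega)
  have log_ge := one_le_log hn
  unfold timeBound
  gcongr

theorem bestOverRoots_time_of_size_le_nine (hP : 3 ≤ P.size) (h9 : P.size ≤ 9) :
    (bestOverRoots P (P.size - 1)).time ≤ 20000 := by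
  have time_le := bestOverRoots_time hP (P.size - 1)
  rw [Nat.sub_add_cancel (by omega)] at time_le
  calc _ ≤ P.size * (204 * P.size + 62) := time_le
    _ ≤ 9 * (204 * 9 + 62) := by gcongr
    _ ≤ 20000 := by norm_num

theorem largerResult_time_le (T S : Option Tri) : (largerResult T S).time ≤ 50 := by
  rcases T with _ | T <;> rcases S with _ | S
  case some.some => exact (larger_time T S).le
  all_goals exact Nat.zero_le _

theorem solve_time_of_size_le_nine (hP : 3 ≤ P.size) (h9 : P.size ≤ 9) :
    (solve choice (d + 1) path P).time ≤ 120000 := by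
  have time_le := bestOverRoots_time_of_size_le_nine hP h9
  rw [solve_of_size_le_nine h9]
  exact (Nat.add_le_add_left time_le 1).trans (by norm_num)

theorem solve_time_of_divide_eq_one (h9 : 9 < P.size)
    (hD : (divide P (choice path % P.size)).val = .one Q) :
    (solve choice (d + 1) path P).time ≤
      (solve choice d (false :: path) Q).time + 700 * P.size := by
  have divide_le := divide_time (show 3 ≤ P.size by omega) (choice path % P.size)
  simp only [solve_of_divide_eq_one h9 hD]
  omega

theorem solve_time_of_divide_eq_two (h9 : 9 < P.size)
    (hD : (divide P (choice path % P.size)).val = .two Q R) :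
    (solve choice (d + 1) path P).time ≤ (solve choice d (false :: path) Q).time +
      (solve choice d (true :: path) R).time + 700 * P.size := by
  have divide_le := divide_time (show 3 ≤ P.size by omega) (choice path % P.size)
  have larger_le := largerResult_time_le (solve choice d (false :: path) Q).val
    (solve choice d (true :: path) R).val
  simp only [solve_of_divide_eq_two h9 hD]
  omega

theorem solve_time_le (h : IsConvexPolygon P) :
    (solve choice d path P).time ≤ timeBound P.size := by
  induction d generalizing P path with
  | zero => exact Nat.cast_zero.trans_le (le_trans (by norm_num) (le_timeBound h.1))
  | succ d ih =>
    rcases le_or_gt P.size 9 with h9 | h9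
    · exact (Nat.cast_le_ofNat.2 (solve_time_of_size_le_nine h.1 h9)).trans (le_timeBound h.1)
    have convex (B) (hB : B ∈ (divide P (choice path % P.size)).val.parts) :=
      isConvexPolygon_of_mem_parts_divide h (by omega) hB
    have size_le (B) (hB : B ∈ (divide P (choice path % P.size)).val.parts) :=
      six_mul_size_le_of_mem_parts_divide h (by omega) hB
    rcases hD : (divide P (choice path % P.size)).val with Q | ⟨Q, R⟩ <;>
      simp only [hD, Split.parts, List.mem_cons, List.not_mem_nil, or_false, forall_eq,
        forall_eq_or_imp] at convex size_le
    · calc ((solve choice (d + 1) path P).time : ℝ)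
        _ ≤ (solve choice d (false :: path) Q).time + 700 * P.size :=
          mod_cast solve_time_of_divide_eq_one h9 hD
        _ ≤ timeBound Q.size + 700 * P.size := by gcongr; exact ih convex
        _ ≤ timeBound P.size := timeBound_add_le h9 convex.size_pos size_le
    · calc ((solve choice (d + 1) path P).time : ℝ)
        _ ≤ (solve choice d (false :: path) Q).time + (solve choice d (true :: path) R).time +
            700 * P.size := mod_cast solve_time_of_divide_eq_two h9 hD
        _ ≤ timeBound Q.size + timeBound R.size + 700 * P.size := by
          gcongr
          exacts [ih convex.1, ih convex.2]
        _ ≤ timeBound P.size :=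
          timeBound_add_timeBound_add_le h9 convex.1.size_pos convex.2.size_pos size_le.1
            size_le.2 (size_add_size_le_of_divide_eq_two h (by omega) hD)

end Time

end InscribedTriangle

open InscribedTriangle in
theorem mainTheorem4 :
    (∀ P : Array Pt, IsConvexPolygon P →
      (∀ r < P.size, IsLargestRooted P (vtx P r) (rootedTriangle P r).val) ∧
      (4 ≤ P.size → ∀ a < P.size,
        (∀ Q ∈ (divide P a).val.parts,
          IsConvexPolygon Q ∧ (∀ p ∈ Q, p ∈ P) ∧ (Q.size : ℝ) ≤ 5 / 6 * ((P.size : ℝ) + 6)) ∧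
        (∀ T : Tri, IsLargest P T → ∃ Q ∈ (divide P a).val.parts, Aligned Q T))) ∧
    (∃ C : ℝ, ∀ P : Array Pt, IsConvexPolygon P → ∀ choice : List Bool → ℕ,
      (∃ T : Tri, (largestTriangle choice P).val = some T ∧ IsLargest P T) ∧
      ((largestTriangle choice P).time : ℝ) ≤ C * (P.size : ℝ) * Real.log (P.size : ℝ)) := by
  refine ⟨fun P h => ⟨fun r _ => isLargestRooted_rootedTriangle h r, fun hn a _ =>
    ⟨fun Q hQ => ⟨isConvexPolygon_of_mem_parts_divide h hn hQ,
      fun p => mem_of_mem_parts_divide h.size_pos hQ, ?_⟩,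
      fun T => exists_mem_parts_divide_aligned h hn a⟩⟩,
    120000, fun P h choice => ⟨solve_val h le_rfl, (solve_time_le h).trans (timeBound_le h.1)⟩⟩
  have size_le : (6 * Q.size : ℝ) ≤ 5 * P.size + 9 :=
    mod_cast six_mul_size_le_of_mem_parts_divide h hn hQ
  linarith
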